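/- Let $\mathbb T=\mathbb R/2\pi\mathbb Z$ with normalized Lebesgue measure $\mu$. Let $X=X(\mathbb T)$ be a Banach function lattice, i.e. a Banach space of measurable functions $f:\mathbb T\to\mathbb C$ (finite and defined at every point; relations between functions and vanishing of the norm are understood $\mu$-almost everywhere) such that: (1) if $f$ is measurable, $g\in X$ and $|f|\le|g|$, then $f\in X$ and $\|f\|_X\le\|g\|_X$; (2) if $f_n\in X$, $\sup_n\|f_n\|_X<\infty$ and $0\le f_n\uparrow f$, then $f\in X$ and $\|f_n\|_X\to\|f\|_X$; (3) for every measurable $E\subset\mathbb T$, $\chi_E\in X$ and there is $c_E>0$ with $\int_E|f|\,d\mu\le c_E\|f\|_X$ for all $f\in X$. For $h>0$ and integrable $f$ put $$A_hf(x)=\frac1h\int_{x-h/2}^{x+h/2}f(t)\,dt,\qquad \dot A_hf(x)=A_hf\Bigl(x+\frac h2\Bigr),$$ and let $S_nf(x)=\sum_{k=-n}^n\widehat f(k)e^{ikx}$ be the Fourier partial sums. With $t_k=t_{k,n}=\frac{2\pi k}{2n+1}$ put $$\mathcal L_nf(x)=\frac1{2n+1}\sum_{k=0}^{2n}f(t_k)D_n(x-t_k),\quad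 D_n(x)=\sum_{k=-n}^ne^{ikx},\qquad \|f\|_{X_n}=\Bigl\|\sum_{k=0}^{2n}|f(t_k)|\,\chi_{[t_k,t_{k+1})}\Bigr\|_X .$$ **Corollary 3.7.** Assume that $A_hf\in X$ for all $f\in X$ and $h>0$, that $\sup_{h>0,\ \|f\|_X\le1}\|A_hf\|_X<\infty$ (Assumption A), and that $\sup_n\|S_n\|_{X\to X}<\infty$. Let $r,s\ge1$ be integers with $2r\ge s$, and let $\gamma>0$ satisfy $\frac{\gamma}{n}\le t_{k+1}-t_k=\frac{2\pi}{2n+1}$ for all $n\ge1$ (that is, $0<\gamma\le 2\pi/3$). Then for every $f\in X$ and every $\alpha\in(0,s)$ the following are equivalent as $n\to\infty$: 1. $\|f-\mathcal L_nf\|_X=\mathcal O(n^{-\alpha})$; 2. $\|(I-A_{\gamma/n})^rf\|_{X_n}+\|(I-\dot A_{\gamma/n})^sf\|_X=\mathcal O(n^{-\alpha})$. -/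

import Mathlib

open MeasureTheory Filter Topology
open scoped ENNReal NNReal

noncomputable section

namespace BanachLatticeSampling

instance factTwoPiPos : Fact ((0 : ℝ) < 2 * Real.pi) := ⟨Real.two_pi_pos⟩

/-- The unit circle `ℝ / 2πℤ`. -/
abbrev Circle2π : Type := AddCircle (2 * Real.pi)

/-- The normalized Lebesgue measure on the circle (total mass one). -/
abbrev circleMeasure : Measure Circle2π := AddCircle.haarAddCircle

/-- A Banach function lattice `X` on the circle. Its elements are genuine complex-valued (finite)
functions, defined at every point. The norm `nrm` is extended by the value `∞` to all functions, so
that `X = {f | nrm f < ∞}`; order relations between functions hold almost everywhere, as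
usual for lattices of measurable functions. -/
structure BanachFunctionLattice where
  /-- The norm of `X`, equal to `∞` outside `X`. -/
  nrm : (Circle2π → ℂ) → ℝ≥0∞
  /-- The elements of `X` are Lebesgue measurable. -/
  aemeasurable : ∀ f, nrm f < ∞ → AEMeasurable f circleMeasure
  /-- Triangle inequality. -/
  add_le : ∀ f g, nrm (fun x => f x + g x) ≤ nrm f + nrm g
  /-- Homogeneity. -/
  smul_eq : ∀ (c : ℂ) (f), nrm (fun x => c * f x) = ‖c‖ₑ * nrm f
  /-- Completeness. -/
  complete : ∀ u : ℕ → Circle2π → ℂ, (∀ n, nrm (u n) < ∞) →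
    (∀ ε : ℝ≥0∞, 0 < ε → ∃ N, ∀ m ≥ N, ∀ n ≥ N, nrm (fun x => u m x - u n x) < ε) →
    ∃ g, nrm g < ∞ ∧ Tendsto (fun n => nrm (fun x => u n x - g x)) atTop (𝓝 0)
  /-- Lattice property: if `f` is measurable, `g ∈ X` and `|f| ≤ |g|`, then `f ∈ X` and
  `‖f‖ ≤ ‖g‖`. -/
  lattice : ∀ f g, AEMeasurable f circleMeasure → nrm g < ∞ →
    (∀ᵐ x ∂circleMeasure, ‖f x‖ ≤ ‖g x‖) → nrm f ≤ nrm g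
  /-- Fatou property: if `0 ≤ u n ↑ g` with `u n ∈ X` bounded in norm, then `g ∈ X` and
  `‖u n‖ → ‖g‖`. -/
  fatou : ∀ (u : ℕ → Circle2π → ℝ) (g : Circle2π → ℝ),
    (⨆ n, nrm (fun x => (u n x : ℂ))) < ∞ →
    (∀ᵐ x ∂circleMeasure, 0 ≤ u 0 x ∧ Monotone (fun n => u n x) ∧
      Tendsto (fun n => u n x) atTop (𝓝 (g x))) →
    nrm (fun x => (g x : ℂ)) < ∞ ∧
      Tendsto (fun n => nrm (fun x => (u n x : ℂ))) atTop (𝓝 (nrm (fun x => (g x : ℂ))))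
  /-- Indicator functions of measurable sets belong to `X`. -/
  indicator_mem : ∀ E : Set Circle2π, MeasurableSet E →
    nrm (E.indicator (fun _ => (1 : ℂ))) < ∞
  /-- `∫_E |f| ≤ c_E ‖f‖` for all `f ∈ X`. -/
  lintegral_le : ∀ E : Set Circle2π, MeasurableSet E →
    ∃ c : ℝ≥0, ∀ f, nrm f < ∞ → ∫⁻ x in E, ‖f x‖ₑ ∂circleMeasure ≤ c * nrm f

/-- Membership `f ∈ X`. -/
def BanachFunctionLattice.Mem (X : BanachFunctionLattice) (f : Circle2π → ℂ) : Prop :=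
  X.nrm f < ∞

/-- The Steklov average `A_h f(x) = (1/h) ∫_{x-h/2}^{x+h/2} f(t) dt`, after the substitution
`t = x + u`. -/
def steklov (h : ℝ) (f : Circle2π → ℂ) (x : Circle2π) : ℂ :=
  ((1 / h : ℝ) : ℂ) * ∫ u in (-(h / 2))..(h / 2), f (x + ((u : ℝ) : Circle2π))

/-- The shifted Steklov average `Ȧ_h f(x) = A_h f(x + h/2)`. -/
def steklovDot (h : ℝ) (f : Circle2π → ℂ) (x : Circle2π) : ℂ :=
  steklov h f (x + ((h / 2 : ℝ) : Circle2π))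

/-- `(I - P)^r f`. -/
def idSubPow (P : (Circle2π → ℂ) → Circle2π → ℂ) (r : ℕ) (f : Circle2π → ℂ) : Circle2π → ℂ :=
  (fun (g : Circle2π → ℂ) (x : Circle2π) => g x - P g x)^[r] f

/-- Steklov averages act in `X` and are bounded uniformly in `h > 0`:
`A_h f ∈ X` for `f ∈ X`, and `sup_{h > 0, ‖f‖ ≤ 1} ‖A_h f‖ < ∞`. -/
def BanachFunctionLattice.SteklovBounded (X : BanachFunctionLattice) : Prop :=
  (∀ f, X.Mem f → ∀ h : ℝ, 0 < h → X.Mem (steklov h f)) ∧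
  ∃ C : ℝ≥0, ∀ f, X.nrm f ≤ 1 → ∀ h : ℝ, 0 < h → X.nrm (steklov h f) ≤ C

/-- The Fourier partial sum `S_n f = ∑_{|k| ≤ n} f̂(k) e^{ikx}`. -/
def fourierPartialSum (n : ℕ) (f : Circle2π → ℂ) (x : Circle2π) : ℂ :=
  ∑ k ∈ Finset.Icc (-(n : ℤ)) n, fourierCoeff f k * fourier k x

/-- `sup_n ‖S_n‖_{X → X} < ∞`. -/
def BanachFunctionLattice.PartialSumsBounded (X : BanachFunctionLattice) : Prop :=
  ∃ C : ℝ≥0, ∀ (n : ℕ) (f), X.Mem f → X.nrm (fourierPartialSum n f) ≤ C * X.nrm f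

/-- The nodes `t_k = 2πk/(2n+1)` as real numbers. -/
def node (n k : ℕ) : ℝ := 2 * Real.pi * k / (2 * n + 1)

/-- The Dirichlet kernel `D_n(x) = ∑_{|k| ≤ n} e^{ikx}`. -/
def dirichlet (n : ℕ) (x : Circle2π) : ℂ :=
  ∑ k ∈ Finset.Icc (-(n : ℤ)) n, fourier k x

/-- The trigonometric Lagrange interpolation polynomial
`𝓛_n f(x) = (1/(2n+1)) ∑_{k=0}^{2n} f(t_k) D_n(x - t_k)`. -/
def lagrange (n : ℕ) (f : Circle2π → ℂ) (x : Circle2π) : ℂ :=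
  (1 / (2 * n + 1) : ℂ) * ∑ k ∈ Finset.range (2 * n + 1),
    f (node n k : Circle2π) * dirichlet n (x - (node n k : Circle2π))

/-- The arc `[a, b)` of the circle. -/
def arc (a b : ℝ) : Set Circle2π := (fun t : ℝ => (t : Circle2π)) '' Set.Ico a b

/-- The discrete seminorm `‖f‖_{X_n} = ‖∑_{k=0}^{2n} |f(t_k)| χ_{[t_k, t_{k+1})}‖_X`. -/
def BanachFunctionLattice.discreteNrm (X : BanachFunctionLattice) (n : ℕ)
    (f : Circle2π → ℂ) : ℝ≥0∞ :=
  X.nrm (fun x => ∑ k ∈ Finset.range (2 * n + 1),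
    (arc (node n k) (node n (k + 1))).indicator
      (fun _ => ((‖f (node n k : Circle2π)‖ : ℝ) : ℂ)) x)

/-- `a_n = O(n^{-α})` as `n → ∞`, for a sequence in `[0, ∞]`. -/
def IsBigORate (a : ℕ → ℝ≥0∞) (α : ℝ) : Prop :=
  ∃ C : ℝ≥0, ∀ᶠ n : ℕ in atTop, a n ≤ C * ENNReal.ofReal ((n : ℝ) ^ (-α))

end BanachLatticeSampling

end

noncomputable section

namespace BanachLatticeSampling

namespace BanachFunctionLattice

variable {X : BanachFunctionLattice}

/-! ### Basic properties of the norm -/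

/-! Everything is a Fourier multiplier estimate. Uniform boundedness of the `S_n` gives, by
modulation and Abel summation, a bound for every finitely supported multiplier by its variation
(`exists_nrm_multiplier_le`). The averages have explicit symbols: with φ(t) = (e^{it} - 1)/(it), the
operator Ȧ_h acts by φ(kh) and A_h by e^{-ikh/2} φ(kh). On frequencies |k| ≤ n with h = γ/n the
argument stays in [-π, π], where φ has no zero. Since 1 - φ has a simple zero at 0 and the symbol of
I - A_h a double one, (I - A_h)^r is dominated on polynomials by (I - Ȧ_h)^{2r}, hence by (I -
Ȧ_h)^s.

Three tools follow. Jackson: f - S_n f is bounded by (I - Ȧ_{γ/n})^s f, because φ²/(1 - φ) has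
bounded variation away from 0. Marcinkiewicz–Zygmund: dividing by φ turns a polynomial into an
average, whose samples are controlled, and turns the step function of the samples into the
interpolant. Bernstein: 1 - φ vanishes at 0.

Point values of f are not controlled by ‖f‖, but those of averages are, and (I - A_h)^r u - u
consists of averages. For 2 ⇒ 1 write f = S_n f + u: the error is u - 𝓛_n u, and the samples of u
differ by averages from those of (I - A_h)^r f - (I - A_h)^r S_n f. For 1 ⇒ 2 the interpolants are
approximants of order n^{-α}, so Bernstein and dyadic telescoping bound (I - Ȧ)^s f; as f - 𝓛_n f
vanishes at the nodes, the discrete term reduces to averages of it and to (I - A_h)^r 𝓛_n f. -/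

theorem nrm_zero : X.nrm (fun _ => 0) = 0 := by
  have h := X.smul_eq 0 (fun _ => 0)
  simpa using h

theorem mem_zero : X.Mem (fun _ => 0) := by
  rw [Mem, nrm_zero]; exact ENNReal.zero_lt_top

theorem Mem.aemeasurable {f : Circle2π → ℂ} (hf : X.Mem f) : AEMeasurable f circleMeasure :=
  X.aemeasurable f hf

theorem Mem.ne_top {f : Circle2π → ℂ} (hf : X.Mem f) : X.nrm f ≠ ∞ :=
  ne_of_lt hf

theorem Mem.add {f g : Circle2π → ℂ} (hf : X.Mem f) (hg : X.Mem g) :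
    X.Mem (fun x => f x + g x) :=
  (X.add_le f g).trans_lt (ENNReal.add_lt_top.2 ⟨hf, hg⟩)

theorem Mem.const_mul {f : Circle2π → ℂ} (hf : X.Mem f) (c : ℂ) : X.Mem (fun x => c * f x) := by
  rw [Mem, X.smul_eq]
  exact ENNReal.mul_lt_top enorm_lt_top hf

theorem sub_le (f g : Circle2π → ℂ) : X.nrm (fun x => f x - g x) ≤ X.nrm f + X.nrm g := by
  have h := X.add_le f (fun x => (-1 : ℂ) * g x)
  rw [X.smul_eq] at h
  simpa [sub_eq_add_neg] using h

theorem Mem.sub {f g : Circle2π → ℂ} (hf : X.Mem f) (hg : X.Mem g) :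
    X.Mem (fun x => f x - g x) :=
  (sub_le f g).trans_lt (ENNReal.add_lt_top.2 ⟨hf, hg⟩)

theorem nrm_sub_comm (f g : Circle2π → ℂ) :
    X.nrm (fun x => f x - g x) = X.nrm (fun x => g x - f x) := by
  have h := X.smul_eq (-1) (fun x => g x - f x)
  simpa using h

theorem le_sub_add (f g : Circle2π → ℂ) : X.nrm f ≤ X.nrm (fun x => f x - g x) + X.nrm g := by
  simpa using X.add_le (fun x => f x - g x) g

theorem Mem.of_norm_le {f g : Circle2π → ℂ} (hg : X.Mem g) (hf : AEMeasurable f circleMeasure)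
    (h : ∀ x, ‖f x‖ ≤ ‖g x‖) : X.Mem f :=
  (X.lattice f g hf hg (.of_forall h)).trans_lt hg

theorem nrm_le_of_norm_le {f g : Circle2π → ℂ} (hg : X.Mem g) (hf : AEMeasurable f circleMeasure)
    (h : ∀ x, ‖f x‖ ≤ ‖g x‖) : X.nrm f ≤ X.nrm g :=
  X.lattice f g hf hg (.of_forall h)

theorem Mem.norm {f : Circle2π → ℂ} (hf : X.Mem f) : X.Mem (fun x => ((‖f x‖ : ℝ) : ℂ)) :=
  hf.of_norm_le (Complex.measurable_ofReal.comp_aemeasurable hf.aemeasurable.norm) (by simp)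

theorem nrm_norm_le {f : Circle2π → ℂ} (hf : X.Mem f) :
    X.nrm (fun x => ((‖f x‖ : ℝ) : ℂ)) ≤ X.nrm f :=
  nrm_le_of_norm_le hf hf.norm.aemeasurable (by simp)

theorem mem_one : X.Mem (fun _ => 1) := by
  simpa [Mem] using X.indicator_mem Set.univ MeasurableSet.univ

theorem mem_of_bounded {f : Circle2π → ℂ} (hf : AEMeasurable f circleMeasure) (c : ℝ)
    (h : ∀ x, ‖f x‖ ≤ c) : X.Mem f :=
  (mem_one.const_mul (c : ℂ)).of_norm_le hf fun x =>
    (h x).trans (by simpa using le_abs_self c)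

theorem mem_of_continuous {f : Circle2π → ℂ} (hf : Continuous f) : X.Mem f := by
  obtain ⟨c, hc⟩ := isCompact_univ.exists_bound_of_continuousOn hf.continuousOn
  exact mem_of_bounded hf.measurable.aemeasurable c fun x => hc x trivial

theorem nrm_sum_le {ι : Type*} (s : Finset ι) (F : ι → Circle2π → ℂ) :
    X.nrm (fun x => ∑ i ∈ s, F i x) ≤ ∑ i ∈ s, X.nrm (F i) := by
  classical
  induction s using Finset.induction_on with
  | empty => simp [nrm_zero]
  | insert i s hi ih =>
    simp only [Finset.sum_insert hi]
    exact (X.add_le _ _).trans (by gcongr)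

variable (X) in
theorem exists_lintegral_le :
    ∃ c : ℝ≥0, ∀ f, X.Mem f → ∫⁻ x, ‖f x‖ₑ ∂circleMeasure ≤ c * X.nrm f := by
  obtain ⟨c, hc⟩ := X.lintegral_le Set.univ MeasurableSet.univ
  exact ⟨c, fun f hf => by simpa using hc f hf⟩

theorem Mem.integrable {f : Circle2π → ℂ} (hf : X.Mem f) : Integrable f circleMeasure := by
  obtain ⟨c, hc⟩ := X.exists_lintegral_le
  exact ⟨hf.aemeasurable.aestronglyMeasurable,
    (hc f hf).trans_lt (ENNReal.mul_lt_top ENNReal.coe_lt_top hf)⟩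

/-- Fatou's lemma for pointwise convergent sequences in a Banach function lattice. -/
theorem nrm_le_of_tendsto {g : ℕ → Circle2π → ℂ} {f : Circle2π → ℂ} {B : ℝ≥0∞} (hB : B < ∞)
    (hg : ∀ n, X.nrm (g n) ≤ B) (hf : AEMeasurable f circleMeasure)
    (hlim : ∀ x, Tendsto (fun n => g n x) atTop (𝓝 (f x))) : X.nrm f ≤ B := by
  have hmem : ∀ n, X.Mem (g n) := fun n => (hg n).trans_lt hB
  -- The Fatou axiom is for increasing sequences; the infima over tails increase to ‖f‖ and lie
  -- below ‖g m‖.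
  set v : ℕ → Circle2π → ℝ := fun m x => ⨅ j, ‖g (m + j) x‖ with hv
  have hbdd : ∀ m x, BddBelow (Set.range fun j => ‖g (m + j) x‖) := fun m x =>
    ⟨0, by rintro _ ⟨j, rfl⟩; positivity⟩
  have hv0 : ∀ m x, 0 ≤ v m x := fun m x => Real.iInf_nonneg fun j => norm_nonneg _
  have hvle : ∀ m j x, v m x ≤ ‖g (m + j) x‖ := fun m j x => ciInf_le (hbdd m x) j
  have hvmono : ∀ x, Monotone fun m => v m x := by
    intro x
    refine monotone_nat_of_le_succ fun m => le_ciInf fun j => ?_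
    have := hvle m (1 + j) x
    rwa [← add_assoc] at this
  have hvlim : ∀ x, Tendsto (fun m => v m x) atTop (𝓝 ‖f x‖) := by
    intro x
    have hn := (hlim x).norm
    rw [Metric.tendsto_atTop] at hn ⊢
    intro ε hε
    obtain ⟨N, hN⟩ := hn (ε / 2) (half_pos hε)
    refine ⟨N, fun m hm => ?_⟩
    have h1 : ‖f x‖ - ε / 2 ≤ v m x := le_ciInf fun j => by
      have := hN (m + j) (by omega)
      rw [Real.dist_eq, abs_lt] at this
      linarith [this.1]
    have h2 := hvle m 0 x
    have h3 := hN m hm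
    rw [Real.dist_eq, abs_lt] at h3 ⊢
    rw [add_zero] at h2
    constructor <;> linarith [h3.1, h3.2]
  have hvmeas : ∀ m, AEMeasurable (fun x => ((v m x : ℝ) : ℂ)) circleMeasure := fun m =>
    Complex.measurable_ofReal.comp_aemeasurable
      (AEMeasurable.iInf fun j => (hmem (m + j)).aemeasurable.norm)
  have hvnrm : ∀ m, X.nrm (fun x => ((v m x : ℝ) : ℂ)) ≤ B := fun m =>
    (nrm_le_of_norm_le (hmem m) (hvmeas m) fun x => by
      simpa [abs_of_nonneg (hv0 m x)] using hvle m 0 x).trans (hg m)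
  obtain ⟨h1, h2⟩ := X.fatou v (fun x => ‖f x‖) ((iSup_le hvnrm).trans_lt hB)
    (.of_forall fun x => ⟨hv0 0 x, hvmono x, hvlim x⟩)
  exact (nrm_le_of_norm_le h1 hf (by simp)).trans (le_of_tendsto' h2 hvnrm)

end BanachFunctionLattice

/-! ### Averages over arcs -/

theorem fourier_apply_add (k : ℤ) (x y : Circle2π) :
    (fourier k (x + y) : ℂ) = fourier k x * fourier k y := by
  simp only [fourier_apply, smul_add, AddCircle.toCircle_add, Circle.coe_mul]

theorem fourier_neg_neg (k : ℤ) (x : Circle2π) : (fourier (-k) (-x) : ℂ) = fourier k x := by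
  simp only [fourier_apply, smul_neg, neg_smul, neg_neg]

theorem norm_fourier_apply (k : ℤ) (x : Circle2π) : ‖(fourier k x : ℂ)‖ = 1 := by
  rw [fourier_apply, Circle.norm_coe]

/-- The average of `f` over the arc `[x + a, x + b]`. -/
def arcMean (a b : ℝ) (f : Circle2π → ℂ) (x : Circle2π) : ℂ :=
  ((1 / (b - a) : ℝ) : ℂ) * ∫ u in a..b, f (x + ((u : ℝ) : Circle2π))

/-- The Fourier multiplier of `arcMean a b`. -/
def arcSymbol (a b : ℝ) (k : ℤ) : ℂ :=
  ((1 / (b - a) : ℝ) : ℂ) * ∫ u in a..b, fourier k ((u : ℝ) : Circle2π)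

/-- Both averages become instances of `arcMean`, so linearity, symbols and iterated differences are
treated once for a general arc. -/
theorem steklov_eq_arcMean (h : ℝ) : steklov h = arcMean (-(h / 2)) (h / 2) := by
  funext f x
  simp only [steklov, arcMean]
  congr 3
  ring

theorem steklovDot_eq_arcMean (h : ℝ) : steklovDot h = arcMean 0 h := by
  funext f x
  simp only [steklovDot, steklov, arcMean]
  congr 1
  · simp
  · have := intervalIntegral.integral_comp_add_left (a := -(h / 2)) (b := h / 2)
      (fun u : ℝ => f (x + (u : Circle2π))) (h / 2)
    simp only [AddCircle.coe_add, ← add_assoc] at this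
    rw [this]
    congr 1 <;> ring

section

variable {f g : Circle2π → ℂ}

theorem integrable_volume (hf : Integrable f circleMeasure) : Integrable f volume := by
  rw [AddCircle.volume_eq_smul_haarAddCircle]
  exact hf.smul_measure ENNReal.ofReal_ne_top

theorem intervalIntegrable_translate (hf : Integrable f circleMeasure) (x : Circle2π) (a b : ℝ) :
    IntervalIntegrable (fun u : ℝ => f (x + (u : Circle2π))) volume a b := by
  have h1 : Integrable (fun y => f (x + y)) (volume : Measure Circle2π) :=
    (integrable_volume hf).comp_add_left x
  have h2 := (AddCircle.measurePreserving_mk (2 * Real.pi) 0).integrable_comp_of_integrable h1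
  refine Function.Periodic.intervalIntegrable (T := 2 * Real.pi) (t := 0) (fun u => ?_)
    Real.two_pi_pos.ne' ?_ a b
  · simp
  · rw [intervalIntegrable_iff_integrableOn_Ioc_of_le (by simpa using Real.two_pi_pos.le)]
    exact h2

theorem arcMean_add (hf : Integrable f circleMeasure) (hg : Integrable g circleMeasure)
    (a b : ℝ) (x : Circle2π) :
    arcMean a b (fun y => f y + g y) x = arcMean a b f x + arcMean a b g x := by
  simp only [arcMean]
  rw [intervalIntegral.integral_add (intervalIntegrable_translate hf x a b)
    (intervalIntegrable_translate hg x a b), mul_add]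

theorem arcMean_sub (hf : Integrable f circleMeasure) (hg : Integrable g circleMeasure)
    (a b : ℝ) (x : Circle2π) :
    arcMean a b (fun y => f y - g y) x = arcMean a b f x - arcMean a b g x := by
  simp only [arcMean]
  rw [intervalIntegral.integral_sub (intervalIntegrable_translate hf x a b)
    (intervalIntegrable_translate hg x a b), mul_sub]

theorem arcMean_const_mul (a b : ℝ) (c : ℂ) (x : Circle2π) :
    arcMean a b (fun y => c * f y) x = c * arcMean a b f x := by
  simp only [arcMean, intervalIntegral.integral_const_mul]
  ring

theorem arcMean_fourier (a b : ℝ) (k : ℤ) (x : Circle2π) :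
    arcMean a b (fourier k) x = arcSymbol a b k * fourier k x := by
  simp only [arcMean, arcSymbol]
  simp_rw [fourier_apply_add, intervalIntegral.integral_const_mul]
  ring

/-- Primitives of integrable functions are continuous. Continuity makes averages bounded, hence
elements of X. -/
theorem continuous_arcMean (hf : Integrable f circleMeasure) (a b : ℝ) :
    Continuous (arcMean a b f) := by
  have hint : ∀ c d : ℝ, IntervalIntegrable (fun u : ℝ => f (u : Circle2π)) volume c d := by
    intro c d
    simpa using intervalIntegrable_translate hf 0 c d
  have hprim := intervalIntegral.continuous_primitive hint 0
  refine (QuotientAddGroup.isQuotientMap_mk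
    (N := AddSubgroup.zmultiples (2 * Real.pi))).continuous_iff.2 ?_
  have : (arcMean a b f ∘ ((↑) : ℝ → Circle2π)) = fun t : ℝ => ((1 / (b - a) : ℝ) : ℂ) *
      ((∫ u in (0 : ℝ)..(t + b), f (u : Circle2π)) - ∫ u in (0 : ℝ)..(t + a), f (u : Circle2π)) := by
    funext t
    simp only [Function.comp, arcMean]
    rw [intervalIntegral.integral_interval_sub_left (hint _ _) (hint _ _)]
    have := intervalIntegral.integral_comp_add_left (a := a) (b := b)
      (fun u : ℝ => f (u : Circle2π)) t
    simp only [AddCircle.coe_add] at this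
    rw [this]
  exact this ▸ by fun_prop

theorem _root_.Continuous.integrable_circleMeasure (hf : Continuous f) :
    Integrable f circleMeasure :=
  hf.integrable_of_hasCompactSupport (HasCompactSupport.of_compactSpace _)

theorem integrable_arcMean (hf : Integrable f circleMeasure) (a b : ℝ) :
    Integrable (arcMean a b f) circleMeasure :=
  (continuous_arcMean hf a b).integrable_circleMeasure

theorem integral_fourier_translate (k : ℤ) (u : Circle2π) :
    ∫ x, fourier (-k) x * f (x + u) ∂circleMeasure = fourier k u * fourierCoeff f k := by
  have h := integral_add_right_eq_self (μ := circleMeasure) (fun y => fourier (-k) (y - u) * f y) u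
  simp only [add_sub_cancel_right] at h
  rw [h, fourierCoeff, ← integral_const_mul]
  congr 1
  funext y
  have : (fourier (-k) (y - u) : ℂ) = fourier k u * fourier (-k) y := by
    rw [sub_eq_add_neg]
    rw [fourier_apply_add, fourier_neg_neg, mul_comm]
  rw [this, smul_eq_mul]
  ring

/-- Fubini and translation invariance of the measure. Having it for every integrable f, not only for
polynomials, is needed in Jackson's inequality. -/
theorem fourierCoeff_arcMean (hf : Integrable f circleMeasure) (a b : ℝ) (k : ℤ) :
    fourierCoeff (arcMean a b f) k = arcSymbol a b k * fourierCoeff f k := by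
  -- f is only a.e. measurable, so null sets must pull back to null sets under (u, x) ↦ x + u; for
  -- fixed u this is a translation.
  have hqmp : Measure.QuasiMeasurePreserving (fun p : ℝ × Circle2π => p.2 + (p.1 : Circle2π))
      ((volume.restrict (Set.uIoc a b)).prod circleMeasure) circleMeasure :=
    QuasiMeasurePreserving.prod_of_right
      (measurable_snd.add (AddCircle.measurable_mk'.comp measurable_fst))
      (.of_forall fun u => (measurePreserving_add_right circleMeasure (u : Circle2π)).quasiMeasurePreserving)
  have hmeas : AEStronglyMeasurable
      (fun p : ℝ × Circle2π => fourier (-k) p.2 * f (p.2 + (p.1 : Circle2π)))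
      ((volume.restrict (Set.uIoc a b)).prod circleMeasure) :=
    AEStronglyMeasurable.mul
      ((map_continuous (fourier (-k))).comp continuous_snd).aestronglyMeasurable
      (hf.aestronglyMeasurable.comp_quasiMeasurePreserving hqmp)
  have hint : Integrable
      (fun p : ℝ × Circle2π => fourier (-k) p.2 * f (p.2 + (p.1 : Circle2π)))
      ((volume.restrict (Set.uIoc a b)).prod circleMeasure) := by
    rw [integrable_prod_iff hmeas]
    refine ⟨.of_forall fun u => ?_, ?_⟩
    · exact (hf.comp_add_right (u : Circle2π)).fourier_smul (-k)
    · have : ∀ u : ℝ, ∫ y, ‖fourier (-k) y * f (y + (u : Circle2π))‖ ∂circleMeasure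
          = ∫ y, ‖f y‖ ∂circleMeasure := by
        intro u
        rw [← integral_add_right_eq_self (fun y => ‖f y‖) (u : Circle2π)]
        simp only [norm_mul, norm_fourier_apply, one_mul]
      simp only [this]
      exact (intervalIntegrable_const (μ := volume)).def'
  have hswap := intervalIntegral_integral_swap (μ := circleMeasure)
    (f := fun u : ℝ => fun x => fourier (-k) x * f (x + (u : Circle2π))) hint
  simp only [integral_fourier_translate, intervalIntegral.integral_mul_const] at hswap
  rw [arcSymbol, mul_assoc, hswap, fourierCoeff, ← integral_const_mul]
  congr 1
  funext x
  simp only [arcMean, smul_eq_mul, intervalIntegral.integral_const_mul]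
  ring

/-- Averages over an arc are dominated by averages of `|f|` over a larger arc. -/
theorem norm_arcMean_le (hf : Integrable f circleMeasure) {a b d H : ℝ} (hab : a < b)
    (ha : d - H / 2 ≤ a) (hb : b ≤ d + H / 2) (x : Circle2π) :
    ‖arcMean a b f x‖ ≤ H / (b - a) *
      ‖steklov H (fun y => ((‖f y‖ : ℝ) : ℂ)) (x + (d : Circle2π))‖ := by
  have hH : 0 < H := by linarith
  have hba : 0 < b - a := sub_pos.2 hab
  have h1 : ‖∫ u in a..b, f (x + (u : Circle2π))‖ ≤
      ∫ u in (d - H / 2)..(d + H / 2), ‖f (x + (u : Circle2π))‖ :=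
    (intervalIntegral.norm_integral_le_integral_norm hab.le).trans
      (intervalIntegral.integral_mono_interval ha hab.le hb
        (.of_forall fun u => norm_nonneg _) (intervalIntegrable_translate hf x _ _).norm)
  have h2 : ∫ u in (d - H / 2)..(d + H / 2), ‖f (x + (u : Circle2π))‖ =
      ∫ u in (-(H / 2))..(H / 2), ‖f (x + (d : Circle2π) + (u : Circle2π))‖ := by
    have := intervalIntegral.integral_comp_add_left (a := -(H / 2)) (b := H / 2)
      (fun u : ℝ => ‖f (x + (u : Circle2π))‖) d
    simp only [AddCircle.coe_add, ← add_assoc] at this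
    rw [this]
    congr 1
  have h3 : 0 ≤ ∫ u in (-(H / 2))..(H / 2), ‖f (x + (d : Circle2π) + (u : Circle2π))‖ :=
    intervalIntegral.integral_nonneg (by linarith) fun u _ => norm_nonneg _
  rw [h2] at h1
  simp only [arcMean, steklov, intervalIntegral.integral_ofReal, norm_mul, Complex.norm_real,
    Real.norm_eq_abs, abs_of_nonneg h3, abs_of_pos (one_div_pos.2 hba),
    abs_of_pos (one_div_pos.2 hH)]
  calc 1 / (b - a) * ‖∫ u in a..b, f (x + (u : Circle2π))‖
      ≤ 1 / (b - a) * ∫ u in (-(H / 2))..(H / 2), ‖f (x + (d : Circle2π) + (u : Circle2π))‖ := by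
        gcongr
    _ = _ := by field_simp

end

/-! ### Boundedness of arc averages in X. -/

namespace BanachFunctionLattice

variable {X : BanachFunctionLattice}

/-- Homogeneity. Division by ‖f‖ fails when it is 0, so f is scaled by an arbitrary t > ‖f‖ and t
then decreases to ‖f‖. -/
theorem SteklovBounded.exists_nrm_le (hA : X.SteklovBounded) :
    ∃ C : ℝ≥0, ∀ f, X.Mem f → ∀ h : ℝ, 0 < h → X.nrm (steklov h f) ≤ C * X.nrm f := by
  obtain ⟨-, C, hC⟩ := hA
  refine ⟨C, fun f hf h hh => ?_⟩
  have key : ∀ t : ℝ≥0, X.nrm f < t → X.nrm (steklov h f) ≤ C * t := by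
    intro t ht
    have ht0 : t ≠ 0 := by rintro rfl; simp at ht
    have h1 : X.nrm (fun x => ((t⁻¹ : ℝ≥0) : ℂ) * f x) ≤ 1 := by
      rw [X.smul_eq]
      have : ‖((t⁻¹ : ℝ≥0) : ℂ)‖ₑ = (t : ℝ≥0∞)⁻¹ := by
        rw [← ENNReal.coe_inv ht0, enorm_eq_nnnorm]
        congr 1
        ext
        simp
      rw [this, mul_comm, ← div_eq_mul_inv]
      exact ENNReal.div_le_of_le_mul (by simpa using ht.le)
    have h2 := hC _ h1 h hh
    have h3 : steklov h f = fun x => (t : ℂ) * steklov h (fun x => ((t⁻¹ : ℝ≥0) : ℂ) * f x) x := by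
      funext x
      rw [steklov_eq_arcMean, arcMean_const_mul, ← mul_assoc]
      have : (t : ℂ) ≠ 0 := by simpa using ht0
      simp [this]
    rw [h3, X.smul_eq, mul_comm]
    have : ‖(t : ℂ)‖ₑ = (t : ℝ≥0∞) := by
      rw [enorm_eq_nnnorm]
      congr 1
      ext
      simp
    rw [this]
    gcongr
  refine ENNReal.le_of_forall_pos_le_add fun ε hε _ => ?_
  obtain ⟨t, ht⟩ : ∃ t : ℝ≥0, X.nrm f = t := ⟨_, (ENNReal.coe_toNNReal hf.ne_top).symm⟩
  -- The denominator is C + 1 because C may be 0.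
  have hpos : 0 < ε / (C + 1) := by positivity
  have h1 := key (t + ε / (C + 1)) (by rw [ht]; exact_mod_cast lt_add_of_pos_right t hpos)
  refine h1.trans ?_
  rw [ht]
  have : C * (t + ε / (C + 1)) ≤ C * t + ε := by
    rw [mul_add]
    gcongr
    rw [← mul_div_assoc]
    refine div_le_of_le_mul₀ (by positivity) (by positivity) ?_
    rw [mul_comm]
    gcongr
    simp
  exact_mod_cast this

theorem mem_arcMean {f : Circle2π → ℂ} (hf : X.Mem f) (a b : ℝ) : X.Mem (arcMean a b f) :=
  mem_of_continuous (continuous_arcMean hf.integrable a b)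

theorem nrm_le_of_norm_le_mul {f g : Circle2π → ℂ} (hg : X.Mem g)
    (hf : AEMeasurable f circleMeasure) {c : ℝ} (h : ∀ x, ‖f x‖ ≤ c * ‖g x‖) :
    X.nrm f ≤ ENNReal.ofReal c * X.nrm g := by
  rcases le_or_gt 0 c with hc | hc
  · refine (nrm_le_of_norm_le (hg.const_mul (c : ℂ)) hf fun x => ?_).trans ?_
    · simpa [abs_of_nonneg hc] using h x
    · rw [X.smul_eq, ← ofReal_norm]
      simp [abs_of_nonneg hc]
  · refine (nrm_le_of_norm_le (g := fun _ => 0) mem_zero hf fun x => ?_).trans (by simp [nrm_zero])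
    have := h x
    have h2 : c * ‖g x‖ ≤ 0 := mul_nonpos_of_nonpos_of_nonneg hc.le (norm_nonneg _)
    simpa using this.trans h2

/-- X need not be translation invariant, so an off-centre arc cannot be moved. It is enclosed in a
centred arc of length H, at the cost of the ratio of lengths; for Ȧ_h one takes H = 2h. -/
theorem SteklovBounded.exists_nrm_arcMean_le (hA : X.SteklovBounded) :
    ∃ C : ℝ≥0, ∀ f, X.Mem f → ∀ a b H : ℝ, a < b → -(H / 2) ≤ a → b ≤ H / 2 →
      X.nrm (arcMean a b f) ≤ ENNReal.ofReal (H / (b - a)) * (C * X.nrm f) := by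
  obtain ⟨C, hC⟩ := hA.exists_nrm_le
  refine ⟨C, fun f hf a b H hab ha hb => ?_⟩
  have hH : 0 < H := by linarith
  refine (nrm_le_of_norm_le_mul (c := H / (b - a)) (hA.1 _ hf.norm H hH)
    (mem_arcMean hf a b).aemeasurable fun x => ?_).trans ?_
  · simpa using norm_arcMean_le hf.integrable (d := 0) hab (by linarith) (by linarith) x
  · gcongr
    exact (hC _ hf.norm H hH).trans (by gcongr; exact nrm_norm_le hf)

theorem SteklovBounded.exists_nrm_steklovDot_le (hA : X.SteklovBounded) :
    ∃ C : ℝ≥0, ∀ f, X.Mem f → ∀ h : ℝ, 0 < h → X.nrm (steklovDot h f) ≤ C * X.nrm f := by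
  obtain ⟨C, hC⟩ := hA.exists_nrm_arcMean_le
  refine ⟨2 * C, fun f hf h hh => ?_⟩
  have := hC f hf 0 h (2 * h) hh (by linarith) (by linarith)
  rw [sub_zero, mul_div_cancel_right₀ _ hh.ne'] at this
  rw [steklovDot_eq_arcMean]
  simpa [mul_assoc] using this

end BanachFunctionLattice

/-! ### Fourier multipliers of bounded variation -/

theorem sum_Icc_int_eq_sum_range {M : Type*} [AddCommMonoid M] (f : ℤ → M) (a : ℤ) (n : ℕ) :
    ∑ k ∈ Finset.Icc a (a + n), f k = ∑ i ∈ Finset.range (n + 1), f (a + i) := by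
  refine (Finset.sum_bij (M := M) (fun (i : ℕ) _ => a + (i : ℤ)) ?_ ?_ ?_ ?_).symm
  · intro i hi
    simp only [Finset.mem_range, Finset.mem_Icc] at *
    omega
  · intro i _ j _ h
    simpa using h
  · intro k hk
    simp only [Finset.mem_Icc] at hk
    exact ⟨(k - a).toNat, by simp only [Finset.mem_range]; omega, by omega⟩
  · intro i _
    rfl

theorem sum_range_mul_eq_abel (m c : ℕ → ℂ) (n : ℕ) :
    ∑ i ∈ Finset.range (n + 1), m i * c i = m n * ∑ i ∈ Finset.range (n + 1), c i +
      ∑ j ∈ Finset.range n, (m j - m (j + 1)) * ∑ i ∈ Finset.range (j + 1), c i := by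
  induction n with
  | zero => simp
  | succ n ih =>
    rw [Finset.sum_range_succ, ih, Finset.sum_range_succ c (n + 1),
      Finset.sum_range_succ (fun j => (m j - m (j + 1)) * ∑ i ∈ Finset.range (j + 1), c i)]
    ring

theorem fourierCoeff_fourier_mul (f : Circle2π → ℂ) (c k : ℤ) :
    fourierCoeff (fun x => fourier (-c) x * f x) k = fourierCoeff f (k + c) := by
  simp only [fourierCoeff]
  congr 1
  funext x
  have : (fourier (-(k + c)) x : ℂ) = fourier (-k) x * fourier (-c) x := by
    rw [neg_add, fourier_add]
  rw [this, smul_eq_mul, smul_eq_mul, mul_assoc]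

theorem norm_fourierCoeff_le (f : Circle2π → ℂ) (k : ℤ) :
    ‖fourierCoeff f k‖ ≤ ∫ x, ‖f x‖ ∂circleMeasure := by
  refine (norm_integral_le_integral_norm _).trans (le_of_eq ?_)
  simp only [norm_smul, norm_fourier_apply, one_mul]

theorem continuous_sum_fourier (s : Finset ℤ) (c : ℤ → ℂ) :
    Continuous (fun x : Circle2π => ∑ k ∈ s, c k * fourier k x) :=
  continuous_finsetSum _ fun _ _ => continuous_const.mul (map_continuous _)

theorem fourierCoeff_sum_fourier (s : Finset ℤ) (c : ℤ → ℂ) (j : ℤ) :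
    fourierCoeff (fun x : Circle2π => ∑ k ∈ s, c k * fourier k x) j = if j ∈ s then c j else 0 := by
  have h1 : (fun x : Circle2π => ∑ k ∈ s, c k * fourier k x) =
      ∑ k ∈ s, (fun x : Circle2π => c k * fourier k x) := by
    funext x
    simp
  have h2 : ∀ k ∈ s, Integrable (fun x : Circle2π => c k * fourier k x) circleMeasure := fun _ _ =>
    (continuous_const.mul (map_continuous _)).integrable_circleMeasure
  rw [h1, fourierCoeff.sum _ _ h2, Finset.sum_apply]
  simp only [fourierCoeff.const_mul, fourierCoeff_fourier, Pi.single_apply, mul_ite, mul_one,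
    mul_zero, Finset.sum_ite_eq]

theorem arcMean_sum_fourier (a b : ℝ) (s : Finset ℤ) (c : ℤ → ℂ) (x : Circle2π) :
    arcMean a b (fun x => ∑ k ∈ s, c k * fourier k x) x =
      ∑ k ∈ s, arcSymbol a b k * c k * fourier k x := by
  classical
  induction s using Finset.induction_on with
  | empty => simp [arcMean]
  | insert k s hk ih =>
    simp only [Finset.sum_insert hk]
    rw [arcMean_add, ih, arcMean_const_mul, arcMean_fourier]
    · ring
    · exact (continuous_const.mul (map_continuous _)).integrable_circleMeasure
    · exact (continuous_sum_fourier s c).integrable_circleMeasure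

namespace BanachFunctionLattice

variable {X : BanachFunctionLattice}

theorem mem_sum_fourier (s : Finset ℤ) (c : ℤ → ℂ) :
    X.Mem (fun x => ∑ k ∈ s, c k * fourier k x) :=
  mem_of_continuous (continuous_sum_fourier s c)

theorem nrm_fourier_mul_le {g : Circle2π → ℂ} (hg : X.Mem g) (c : ℤ) :
    X.Mem (fun x => fourier c x * g x) ∧ X.nrm (fun x => fourier c x * g x) ≤ X.nrm g := by
  have hm : AEMeasurable (fun x => fourier c x * g x) circleMeasure :=
    (map_continuous (fourier c)).measurable.aemeasurable.mul hg.aemeasurable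
  have h : ∀ x, ‖fourier c x * g x‖ ≤ ‖g x‖ := fun x => by
    rw [norm_mul, norm_fourier_apply, one_mul]
  exact ⟨hg.of_norm_le hm h, nrm_le_of_norm_le hg hm h⟩

/-- Multiplying by a character keeps the modulus and shifts the spectrum, so a window with a central
frequency is a modulated S_n. A window of even cardinality needs one further frequency, whence 2C.
-/
theorem PartialSumsBounded.exists_nrm_sum_Icc_le (hS : X.PartialSumsBounded) :
    ∃ K : ℝ≥0, ∀ (a b : ℤ) (g), X.Mem g →
      X.nrm (fun x => ∑ k ∈ Finset.Icc a b, fourierCoeff g k * fourier k x) ≤ K * X.nrm g := by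
  obtain ⟨C, hC⟩ := hS
  have even : ∀ (c : ℤ) (n : ℕ) (g), X.Mem g →
      X.nrm (fun x => ∑ k ∈ Finset.Icc (-(n : ℤ) + c) (n + c), fourierCoeff g k * fourier k x)
        ≤ C * X.nrm g := by
    intro c n g hg
    obtain ⟨h1, h2⟩ := nrm_fourier_mul_le hg (-c)
    have h3 : (fun x => ∑ k ∈ Finset.Icc (-(n : ℤ) + c) (n + c), fourierCoeff g k * fourier k x) =
        fun x => fourier c x * fourierPartialSum n (fun x => fourier (-c) x * g x) x := by
      funext x
      rw [← Finset.image_add_right_Icc, Finset.sum_image (fun i _ j _ h => by simpa using h),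
        fourierPartialSum, Finset.mul_sum]
      refine Finset.sum_congr rfl fun k _ => ?_
      rw [fourierCoeff_fourier_mul, fourier_add]
      ring
    rw [h3]
    calc _ ≤ X.nrm (fourierPartialSum n (fun x => fourier (-c) x * g x)) :=
          (nrm_fourier_mul_le (mem_sum_fourier _ _) c).2
      _ ≤ C * X.nrm (fun x => fourier (-c) x * g x) := hC n _ h1
      _ ≤ C * X.nrm g := by gcongr
  refine ⟨2 * C, fun a b g hg => ?_⟩
  rcases lt_or_ge b a with hab | hab
  · simp [Finset.Icc_eq_empty_of_lt hab, nrm_zero]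
  obtain ⟨n, hn⟩ := Int.eq_ofNat_of_zero_le (sub_nonneg.2 hab)
  obtain ⟨j, hj⟩ := Nat.even_or_odd' n
  rcases hj with hj | hj
  · have := even (a + j) j g hg
    rw [show -(j : ℤ) + (a + j) = a by ring, show (j : ℤ) + (a + j) = b by omega] at this
    refine this.trans ?_
    gcongr
    exact le_mul_of_one_le_left zero_le one_le_two
  · have h1 := even (a + j) j g hg
    rw [show -(j : ℤ) + (a + j) = a by ring, show (j : ℤ) + (a + j) = b - 1 by omega] at h1
    have h2 := even b 0 g hg
    simp only [Nat.cast_zero, neg_zero, zero_add, Finset.Icc_self, Finset.sum_singleton] at h2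
    have h3 : (fun x : Circle2π => ∑ k ∈ Finset.Icc a b, fourierCoeff g k * fourier k x) = fun x =>
        ∑ k ∈ Finset.Icc a (b - 1), fourierCoeff g k * fourier k x +
          fourierCoeff g b * fourier b x := by
      funext x
      have : Finset.Icc a b = insert b (Finset.Icc a (b - 1)) := by
        ext k
        simp only [Finset.mem_Icc, Finset.mem_insert]
        omega
      rw [this, Finset.sum_insert (by simp), add_comm]
    rw [h3]
    refine (X.add_le _ _).trans ((add_le_add h1 h2).trans (le_of_eq ?_))
    push_cast
    ring

/-- Multipliers of bounded variation supported in a finite interval are bounded in `X`. -/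
theorem PartialSumsBounded.exists_nrm_multiplier_le (hS : X.PartialSumsBounded) :
    ∃ K : ℝ≥0, ∀ (m : ℤ → ℂ) (a : ℤ) (n : ℕ) (V : ℝ),
      ‖m (a + n)‖ + ∑ i ∈ Finset.range n, ‖m (a + i) - m (a + (i + 1))‖ ≤ V → ∀ g, X.Mem g →
      X.nrm (fun x => ∑ k ∈ Finset.Icc a (a + n), m k * fourierCoeff g k * fourier k x) ≤
        K * ENNReal.ofReal V * X.nrm g := by
  obtain ⟨K, hK⟩ := hS.exists_nrm_sum_Icc_le
  refine ⟨K, fun m a n V hV g hg => ?_⟩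
  set S : ℕ → Circle2π → ℂ := fun j x =>
    ∑ k ∈ Finset.Icc a (a + j), fourierCoeff g k * fourier k x with hSdef
  -- Abel summation: the multiplier is a combination of window sums whose weights have total modulus
  -- at most V.
  have h1 : (fun x => ∑ k ∈ Finset.Icc a (a + n), m k * fourierCoeff g k * fourier k x) = fun x =>
      m (a + n) * S n x +
        ∑ i ∈ Finset.range n, (m (a + i) - m (a + (i + 1))) * S i x := by
    funext x
    simp only [hSdef, sum_Icc_int_eq_sum_range, mul_assoc]
    simpa using sum_range_mul_eq_abel (fun i => m (a + i))
      (fun i => fourierCoeff g (a + i) * fourier (a + i) x) n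
  have hSle : ∀ j : ℕ, X.nrm (S j) ≤ K * X.nrm g := fun j => hK a (a + j) g hg
  rw [h1]
  calc X.nrm (fun x => m (a + n) * S n x +
        ∑ i ∈ Finset.range n, (m (a + i) - m (a + (i + 1))) * S i x)
      ≤ ‖m (a + n)‖ₑ * X.nrm (S n) +
        ∑ i ∈ Finset.range n, ‖m (a + i) - m (a + (i + 1))‖ₑ * X.nrm (S i) := by
        refine (X.add_le _ _).trans ?_
        rw [X.smul_eq]
        gcongr
        refine (nrm_sum_le _ _).trans (Finset.sum_le_sum fun i _ => ?_)
        rw [X.smul_eq]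
    _ ≤ ‖m (a + n)‖ₑ * (K * X.nrm g) +
        ∑ i ∈ Finset.range n, ‖m (a + i) - m (a + (i + 1))‖ₑ * (K * X.nrm g) := by
        gcongr with i _
        · exact hSle n
        · exact hSle i
    _ = ENNReal.ofReal (‖m (a + n)‖ +
          ∑ i ∈ Finset.range n, ‖m (a + i) - m (a + (i + 1))‖) * (K * X.nrm g) := by
        rw [ENNReal.ofReal_add (norm_nonneg _) (Finset.sum_nonneg fun i _ => norm_nonneg _),
          ENNReal.ofReal_sum_of_nonneg fun i _ => norm_nonneg _]
        simp only [ofReal_norm, add_mul, Finset.sum_mul]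
    _ ≤ ENNReal.ofReal V * (K * X.nrm g) := by gcongr
    _ = K * ENNReal.ofReal V * X.nrm g := by ring

end BanachFunctionLattice

/-! ### The symbol of the shifted Steklov average -/

/-- The entire function `(e^z - 1) / z`. -/
def expQuot (z : ℂ) : ℂ := dslope Complex.exp 0 z

theorem differentiable_dslope {f : ℂ → ℂ} (hf : Differentiable ℂ f) (c : ℂ) :
    Differentiable ℂ (dslope f c) :=
  differentiableOn_univ.1 <| (Complex.differentiableOn_dslope univ_mem).2 hf.differentiableOn

theorem mul_dslope_zero (f : ℂ → ℂ) (z : ℂ) : z * dslope f 0 z = f z - f 0 := by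
  simpa using sub_smul_dslope f 0 z

theorem differentiable_expQuot : Differentiable ℂ expQuot :=
  differentiable_dslope Complex.differentiable_exp 0

theorem expQuot_zero : expQuot 0 = 1 := by
  simp [expQuot, dslope_same]

theorem mul_expQuot (z : ℂ) : z * expQuot z = Complex.exp z - 1 := by
  rw [expQuot, mul_dslope_zero, Complex.exp_zero]

/-- Differentiate z E(z) = e^z - 1 twice at 0. The value matters twice: it is nonzero, so 1 - φ has
a simple zero, and it cancels the derivative -1/2 of e^{-z/2}. -/
theorem deriv_expQuot_zero : deriv expQuot 0 = 1 / 2 := by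
  have hd : ∀ z, HasDerivAt expQuot (deriv expQuot z) z := fun z =>
    (differentiable_expQuot z).hasDerivAt
  have hd2 : HasDerivAt (deriv expQuot) (deriv (deriv expQuot) 0) 0 :=
    (differentiable_expQuot.contDiff (n := 2)).differentiable_deriv_two 0 |>.hasDerivAt
  have h1 : ∀ z, expQuot z + z * deriv expQuot z = Complex.exp z := by
    intro z
    have h := (hasDerivAt_id z).mul (hd z)
    have h' : HasDerivAt (fun z => Complex.exp z - 1) (Complex.exp z) z :=
      (Complex.hasDerivAt_exp z).sub_const 1
    have heq : (id * expQuot) = fun z => Complex.exp z - 1 := by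
      funext z
      exact mul_expQuot z
    rw [heq] at h
    simpa using h.unique h'
  have h2 := (hd 0).add ((hasDerivAt_id (0 : ℂ)).mul hd2)
  have heq : (expQuot + id * deriv expQuot) = Complex.exp := by
    funext z
    exact h1 z
  rw [heq] at h2
  have h3 := h2.unique (Complex.hasDerivAt_exp 0)
  simp at h3
  linear_combination h3 / 2

theorem abs_mul_norm_expQuot (t : ℝ) :
    |t| * ‖expQuot (t * Complex.I)‖ = ‖Complex.exp (t * Complex.I) - 1‖ := by
  rw [← mul_expQuot, norm_mul]
  simp

theorem abs_mul_norm_expQuot_le (t : ℝ) : |t| * ‖expQuot (t * Complex.I)‖ ≤ 2 := by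
  rw [abs_mul_norm_expQuot]
  refine (_root_.norm_sub_le _ _).trans ?_
  rw [Complex.norm_exp_ofReal_mul_I]
  norm_num

theorem norm_expQuot_le_one (t : ℝ) : ‖expQuot (t * Complex.I)‖ ≤ 1 := by
  rcases eq_or_ne t 0 with rfl | ht
  · simp [expQuot_zero]
  · refine le_of_mul_le_mul_left ?_ (abs_pos.2 ht)
    rw [abs_mul_norm_expQuot, mul_one, mul_comm]
    exact Real.norm_exp_I_mul_ofReal_sub_one_le

/-- Equality would give e^{it} = 1 + it, whose modulus exceeds 1. -/
theorem expQuot_ne_one {t : ℝ} (ht : t ≠ 0) : expQuot (t * Complex.I) ≠ 1 := by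
  intro h
  have h1 := mul_expQuot (t * Complex.I)
  rw [h] at h1
  have h2 : Complex.exp (t * Complex.I) = 1 + t * Complex.I := by linear_combination -h1
  have h3 := congrArg Complex.normSq h2
  rw [Complex.normSq_eq_norm_sq, Complex.norm_exp_ofReal_mul_I, Complex.normSq_apply] at h3
  simp at h3
  exact ht h3

/-- The zeros of φ are the nonzero multiples of 2π, outside the range |kh| ≤ π of the frequencies in
use. -/
theorem expQuot_ne_zero {t : ℝ} (ht : |t| ≤ Real.pi) : expQuot (t * Complex.I) ≠ 0 := by
  intro h
  have h1 := mul_expQuot (t * Complex.I)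
  rw [h, mul_zero] at h1
  have h2 : Complex.exp (t * Complex.I) = 1 := by linear_combination -h1
  obtain ⟨n, hn⟩ := Complex.exp_eq_one_iff.1 h2
  have h3 : t = n * (2 * Real.pi) := by
    have := congrArg Complex.im hn
    simpa using this
  have hn0 : n ≠ 0 := by
    rintro rfl
    simp only [Int.cast_zero, zero_mul] at h3
    rw [h3] at h
    simp [expQuot_zero] at h
  have h4 : (1 : ℝ) ≤ |(n : ℝ)| := by exact_mod_cast Int.one_le_abs hn0
  rw [h3, abs_mul, abs_of_pos Real.two_pi_pos] at ht
  nlinarith [Real.pi_pos]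

theorem arcSymbol_eq {a b : ℝ} (hab : a < b) (k : ℤ) :
    arcSymbol a b k =
      Complex.exp ((k * a : ℝ) * Complex.I) * expQuot ((k * (b - a) : ℝ) * Complex.I) := by
  have hba : ((b : ℂ) - a) ≠ 0 := by
    rw [← Complex.ofReal_sub]
    exact_mod_cast (sub_pos.2 hab).ne'
  have hf : ∀ u : ℝ, (fourier k (u : Circle2π) : ℂ) = Complex.exp ((k * Complex.I) * u) := by
    intro u
    rw [fourier_coe_apply]
    congr 1
    have : (Real.pi : ℂ) ≠ 0 := by exact_mod_cast Real.pi_ne_zero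
    push_cast
    field_simp
  simp only [arcSymbol, hf]
  rcases eq_or_ne k 0 with rfl | hk
  · simp [expQuot_zero, hba]
  · have hk' : (k : ℂ) ≠ 0 := by exact_mod_cast hk
    have hkI : (k * Complex.I : ℂ) ≠ 0 := mul_ne_zero hk' Complex.I_ne_zero
    rw [integral_exp_mul_complex hkI]
    have h1 := mul_expQuot ((k * (b - a) : ℝ) * Complex.I)
    have h2 : Complex.exp (k * Complex.I * b) = Complex.exp ((k * a : ℝ) * Complex.I) *
        Complex.exp ((k * (b - a) : ℝ) * Complex.I) := by
      rw [← Complex.exp_add]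
      congr 1
      push_cast
      ring
    have h3 : Complex.exp (k * Complex.I * a) = Complex.exp ((k * a : ℝ) * Complex.I) := by
      congr 1
      push_cast
      ring
    rw [h2, h3, ← mul_sub_one, ← h1]
    push_cast
    field_simp

theorem arcSymbol_zero_left {h : ℝ} (hh : 0 < h) (k : ℤ) :
    arcSymbol 0 h k = expQuot ((k * h : ℝ) * Complex.I) := by
  simp [arcSymbol_eq hh]

theorem arcSymbol_neg_half {h : ℝ} (hh : 0 < h) (k : ℤ) :
    arcSymbol (-(h / 2)) (h / 2) k =
      Complex.exp (-((k * h : ℝ) * Complex.I) / 2) * expQuot ((k * h : ℝ) * Complex.I) := by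
  rw [arcSymbol_eq (by linarith)]
  congr 2
  · push_cast
    ring
  · ring_nf

/-- The symbol of `I - A_h` is divisible by the square of the symbol of `I - Ȧ_h`. -/
theorem exists_analytic_quotient_symbol :
    ∃ κ : ℂ → ℂ, ∀ t : ℝ, AnalyticAt ℂ κ (t * Complex.I) ∧
      1 - Complex.exp (-(t * Complex.I) / 2) * expQuot (t * Complex.I) =
        κ (t * Complex.I) * (1 - expQuot (t * Complex.I)) ^ 2 := by
  set w : ℂ → ℂ := fun z => Complex.exp (-z / 2) * expQuot z with hw
  have hexp : Differentiable ℂ fun z : ℂ => Complex.exp (-z / 2) := by fun_prop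
  have hwd : Differentiable ℂ w := hexp.mul differentiable_expQuot
  have hw1 : w 0 = 1 := by simp [hw, expQuot_zero]
  -- The centred average has an even symbol, so 1 - w vanishes to second order.
  have hw' : deriv w 0 = 0 := by
    have h1 : HasDerivAt (fun z : ℂ => Complex.exp (-z / 2)) (-1 / 2) 0 := by
      have : HasDerivAt (fun z : ℂ => -z / 2) (-1 / 2) 0 := by
        simpa using ((hasDerivAt_id (0 : ℂ)).neg.div_const 2)
      simpa using this.cexp
    have h2 := h1.mul (differentiable_expQuot 0).hasDerivAt
    rw [deriv_expQuot_zero] at h2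
    refine h2.deriv.trans ?_
    simp [expQuot_zero]
    norm_num
  -- Removing zeros gives w = 1 + z² a₂ and φ = 1 + z b, so the quotient is -a₂ / b², with b free of
  -- zeros on the imaginary axis.
  set a₁ := dslope w 0 with ha₁
  set a₂ := dslope a₁ 0 with ha₂
  set b := dslope expQuot 0 with hb
  have ha₂d : Differentiable ℂ a₂ := differentiable_dslope (differentiable_dslope hwd 0) 0
  have hbd : Differentiable ℂ b := differentiable_dslope differentiable_expQuot 0
  have h1 : ∀ z, z * a₁ z = w z - 1 := fun z => by rw [ha₁, mul_dslope_zero, hw1]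
  have h2 : ∀ z, z * a₂ z = a₁ z := fun z => by
    rw [ha₂, mul_dslope_zero, ha₁, dslope_same, hw', sub_zero]
  have h3 : ∀ z, z * b z = expQuot z - 1 := fun z => by rw [hb, mul_dslope_zero, expQuot_zero]
  have hb0 : ∀ t : ℝ, b (t * Complex.I) ≠ 0 := by
    intro t
    rcases eq_or_ne t 0 with rfl | ht
    · simp [hb, dslope_same, deriv_expQuot_zero]
    · intro h
      have := h3 (t * Complex.I)
      rw [h, mul_zero] at this
      exact expQuot_ne_one ht (by linear_combination -this)
  refine ⟨fun z => -a₂ z / b z ^ 2, fun t => ⟨?_, ?_⟩⟩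
  · exact (ha₂d.analyticAt _).neg.div ((hbd.analyticAt _).pow 2) (pow_ne_zero 2 (hb0 t))
  · have hb' := hb0 t
    have e1 : 1 - w (t * Complex.I) = -((t * Complex.I) ^ 2 * a₂ (t * Complex.I)) := by
      linear_combination h1 (t * Complex.I) + (t * Complex.I) * h2 (t * Complex.I)
    have e2 : 1 - expQuot (t * Complex.I) = -((t * Complex.I) * b (t * Complex.I)) := by
      linear_combination h3 (t * Complex.I)
    change 1 - w (t * Complex.I) = _
    rw [e1, e2]
    field_simp

/-- An analytic function is Lipschitz on the segment `[-πi, πi]`. -/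
theorem exists_lipschitz_on_segment {f : ℂ → ℂ}
    (hf : ∀ t : ℝ, |t| ≤ Real.pi → AnalyticAt ℂ f (t * Complex.I)) :
    ∃ C : ℝ, 0 ≤ C ∧ ∀ s t : ℝ, |s| ≤ Real.pi → |t| ≤ Real.pi →
      ‖f (s * Complex.I) - f (t * Complex.I)‖ ≤ C * |s - t| := by
  have hg : ∀ t ∈ Set.Icc (-Real.pi) Real.pi,
      HasDerivAt (fun t : ℝ => f (t * Complex.I)) (deriv f (t * Complex.I) * Complex.I) t := by
    intro t ht
    have h1 := (hf t (abs_le.2 ht)).differentiableAt.hasDerivAt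
    have h2 : HasDerivAt (fun t : ℝ => (t : ℂ) * Complex.I) Complex.I t := by
      simpa using (Complex.ofRealCLM.hasDerivAt (x := t)).mul_const Complex.I
    exact h1.comp t h2
  have hcont : ContinuousOn (fun t : ℝ => deriv f (t * Complex.I) * Complex.I)
      (Set.Icc (-Real.pi) Real.pi) := by
    intro t ht
    have h1 := (hf t (abs_le.2 ht)).deriv.continuousAt
    have h2 : ContinuousAt (fun t : ℝ => (t : ℂ) * Complex.I) t := by fun_prop
    exact ((h1.comp_of_eq h2 rfl).mul continuousAt_const).continuousWithinAt
  obtain ⟨C, hC⟩ := isCompact_Icc.exists_bound_of_continuousOn hcont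
  refine ⟨|C|, abs_nonneg _, fun s t hs ht => ?_⟩
  have := (convex_Icc (-Real.pi) Real.pi).norm_image_sub_le_of_norm_hasDerivWithin_le
    (fun x hx => (hg x hx).hasDerivWithinAt) (fun x hx => (hC x hx).trans (le_abs_self C))
    (abs_le.1 ht) (abs_le.1 hs)
  simpa using this

/-- For |t| > 4 the bound |φ| ≤ 2/|t| gives at least 1/2; on the remaining compact set 1 - φ is
continuous without zeros. -/
theorem exists_le_norm_one_sub_expQuot {γ : ℝ} (hγ : 0 < γ) :
    ∃ c : ℝ, 0 < c ∧ ∀ t : ℝ, γ ≤ |t| → c ≤ ‖1 - expQuot (t * Complex.I)‖ := by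
  have hcont : Continuous fun t : ℝ => ‖1 - expQuot (t * Complex.I)‖ := by
    have := differentiable_expQuot.continuous
    fun_prop
  set K : Set ℝ := Set.Icc (-4) 4 ∩ {t | γ ≤ |t|} with hK
  have hKc : IsCompact K :=
    isCompact_Icc.inter_right (isClosed_le continuous_const continuous_abs)
  obtain ⟨c, hc, hcK⟩ : ∃ c : ℝ, 0 < c ∧ ∀ t ∈ K, c ≤ ‖1 - expQuot (t * Complex.I)‖ := by
    rcases K.eq_empty_or_nonempty with he | hne
    · exact ⟨1, one_pos, by simp [he]⟩
    · obtain ⟨t₀, ht₀, hmin⟩ := hKc.exists_isMinOn hne hcont.continuousOn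
      refine ⟨_, norm_pos_iff.2 (sub_ne_zero.2 (expQuot_ne_one ?_).symm), fun t ht => hmin ht⟩
      exact abs_pos.1 (hγ.trans_le ht₀.2)
  refine ⟨min c (1 / 2), by positivity, fun t ht => ?_⟩
  rcases le_or_gt |t| 4 with h4 | h4
  · exact (min_le_left _ _).trans (hcK t ⟨abs_le.1 h4, ht⟩)
  · refine (min_le_right _ _).trans ?_
    have h1 := abs_mul_norm_expQuot_le t
    have h2 : ‖expQuot (t * Complex.I)‖ ≤ 1 / 2 := by
      nlinarith [norm_nonneg (expQuot (t * Complex.I))]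
    have h3 := norm_sub_norm_le (1 : ℂ) (expQuot (t * Complex.I))
    rw [norm_one] at h3
    linarith

/-- is(φ(s) - φ(t)) = (e^{is} - e^{it}) - i(s - t)φ(t), and each term is at most |s - t|. The
increments of φ thus decay like 1/|s|. -/
theorem abs_mul_norm_expQuot_sub_le (s t : ℝ) :
    |s| * ‖expQuot (s * Complex.I) - expQuot (t * Complex.I)‖ ≤ 2 * |s - t| := by
  have h1 : (s * Complex.I) * (expQuot (s * Complex.I) - expQuot (t * Complex.I)) =
      Complex.exp (t * Complex.I) * (Complex.exp ((s - t : ℝ) * Complex.I) - 1) -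
        ((s - t : ℝ) * Complex.I) * expQuot (t * Complex.I) := by
    have e : Complex.exp (s * Complex.I) =
        Complex.exp (t * Complex.I) * Complex.exp ((s - t : ℝ) * Complex.I) := by
      rw [← Complex.exp_add]
      congr 1
      push_cast
      ring
    have e1 := mul_expQuot (s * Complex.I)
    have e2 := mul_expQuot (t * Complex.I)
    rw [e] at e1
    push_cast at *
    linear_combination e1 - e2
  have h2 := congrArg norm h1
  rw [norm_mul] at h2
  have h3 : ‖(s : ℂ) * Complex.I‖ = |s| := by simp
  rw [h3] at h2
  rw [h2]
  refine (_root_.norm_sub_le _ _).trans ?_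
  rw [norm_mul, norm_mul, Complex.norm_exp_ofReal_mul_I, one_mul]
  have h4 : ‖Complex.exp ((s - t : ℝ) * Complex.I) - 1‖ ≤ |s - t| := by
    rw [mul_comm]
    exact Real.norm_exp_I_mul_ofReal_sub_one_le
  have h5 : ‖((s - t : ℝ) : ℂ) * Complex.I‖ = |s - t| := by
    rw [norm_mul, Complex.norm_real, Complex.norm_I, mul_one, Real.norm_eq_abs]
  rw [h5]
  nlinarith [norm_expQuot_le_one t, abs_nonneg (s - t)]

/-- The symbol `φ² / (1 - φ)` of `Ȧ_h² (I - Ȧ_h)⁻¹`. -/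
def tailSymbol (t : ℝ) : ℂ := expQuot (t * Complex.I) ^ 2 / (1 - expQuot (t * Complex.I))

/-- The square in the numerator pays off here: with p = φ(s), q = φ(t) the increment is (p - q)(p +
q - pq)/((1 - p)(1 - q)). One decaying factor comes from p - q and a second from p or q, so the
increments become summable over frequencies. -/
theorem exists_norm_tailSymbol_sub_le {γ : ℝ} (hγ : 0 < γ) :
    ∃ C : ℝ, 0 ≤ C ∧ (∀ t : ℝ, γ ≤ |t| → ‖tailSymbol t‖ ≤ C) ∧
      ∀ s t : ℝ, γ ≤ |s| → γ ≤ |t| → ‖tailSymbol s - tailSymbol t‖ ≤ C * |s - t| / (|s| * |t|) := by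
  obtain ⟨c, hc, hct⟩ := exists_le_norm_one_sub_expQuot hγ
  refine ⟨1 / c + 12 / c ^ 2, by positivity, fun t ht => ?_, ?_⟩
  · rw [tailSymbol, norm_div, norm_pow]
    have h1 : ‖expQuot (t * Complex.I)‖ ^ 2 ≤ 1 := pow_le_one₀ (norm_nonneg _) (norm_expQuot_le_one t)
    calc ‖expQuot (t * Complex.I)‖ ^ 2 / ‖1 - expQuot (t * Complex.I)‖ ≤ 1 / c := by
          gcongr
          exact hct t ht
      _ ≤ _ := by
          have : 0 ≤ 12 / c ^ 2 := by positivity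
          linarith
  · intro s t hs ht
    have hs0 : 0 < |s| := hγ.trans_le hs
    have ht0 : 0 < |t| := hγ.trans_le ht
    have hcs := hct s hs
    have hctt := hct t ht
    have hd1 := abs_mul_norm_expQuot_sub_le s t
    have hd2 := abs_mul_norm_expQuot_sub_le t s
    have hs2 := abs_mul_norm_expQuot_le s
    have ht2 := abs_mul_norm_expQuot_le t
    have ht1 := norm_expQuot_le_one t
    simp only [tailSymbol]
    set p := expQuot (s * Complex.I)
    set q := expQuot (t * Complex.I)
    rw [norm_sub_rev, abs_sub_comm] at hd2
    have hp : (1 - p) ≠ 0 := norm_pos_iff.1 (hc.trans_le hcs)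
    have hq : (1 - q) ≠ 0 := norm_pos_iff.1 (hc.trans_le hctt)
    have e : p ^ 2 / (1 - p) - q ^ 2 / (1 - q) = (p - q) * (p + q - p * q) / ((1 - p) * (1 - q)) := by
      field_simp
      ring
    have hsum : ‖p + q - p * q‖ ≤ 2 * ‖p‖ + ‖q‖ := by
      refine (_root_.norm_sub_le _ _).trans ?_
      rw [norm_mul]
      have := norm_add_le p q
      nlinarith [norm_nonneg p, norm_nonneg q]
    -- The weight missing from p or q is given to p - q; the three products are each at most 4|s -
    -- t|, which makes 12.
    have hnum : ‖p - q‖ * ‖p + q - p * q‖ * (|s| * |t|) ≤ 12 * |s - t| := by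
      have h0 := norm_nonneg (p - q)
      have k1 : (|t| * ‖p - q‖) * (|s| * ‖p‖) ≤ (2 * |s - t|) * 2 := by gcongr
      have k2 : (|s| * ‖p - q‖) * (|t| * ‖q‖) ≤ (2 * |s - t|) * 2 := by gcongr
      calc ‖p - q‖ * ‖p + q - p * q‖ * (|s| * |t|)
          ≤ ‖p - q‖ * (2 * ‖p‖ + ‖q‖) * (|s| * |t|) := by gcongr
        _ = 2 * ((|t| * ‖p - q‖) * (|s| * ‖p‖)) + (|s| * ‖p - q‖) * (|t| * ‖q‖) := by ring
        _ ≤ 12 * |s - t| := by linarith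
    rw [e, norm_div, norm_mul, norm_mul]
    calc ‖p - q‖ * ‖p + q - p * q‖ / (‖1 - p‖ * ‖1 - q‖)
        ≤ (12 * |s - t| / (|s| * |t|)) / (c * c) := by
          gcongr
          rwa [le_div_iff₀ (by positivity)]
      _ = 12 / c ^ 2 * |s - t| / (|s| * |t|) := by field_simp
      _ ≤ _ := by
          gcongr
          have : 0 ≤ 1 / c := by positivity
          linarith

/-! ### Iterated differences `(I - P)^r` -/

theorem idSubPow_zero (P : (Circle2π → ℂ) → Circle2π → ℂ) (f : Circle2π → ℂ) :
    idSubPow P 0 f = f := rfl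

theorem idSubPow_succ (P : (Circle2π → ℂ) → Circle2π → ℂ) (r : ℕ) (f : Circle2π → ℂ) :
    idSubPow P (r + 1) f = idSubPow P r (fun x => f x - P f x) := rfl

theorem idSubPow_succ' (P : (Circle2π → ℂ) → Circle2π → ℂ) (r : ℕ) (f : Circle2π → ℂ) :
    idSubPow P (r + 1) f = fun x => idSubPow P r f x - P (idSubPow P r f) x :=
  Function.iterate_succ_apply' _ _ _

theorem idSubPow_add (P : (Circle2π → ℂ) → Circle2π → ℂ) (r s : ℕ) (f : Circle2π → ℂ) :
    idSubPow P (r + s) f = idSubPow P r (idSubPow P s f) :=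
  Function.iterate_add_apply _ _ _ _

theorem integrable_idSubPow {f : Circle2π → ℂ} (hf : Integrable f circleMeasure) (a b : ℝ) (r : ℕ) :
    Integrable (idSubPow (arcMean a b) r f) circleMeasure := by
  induction r with
  | zero => exact hf
  | succ r ih =>
    rw [idSubPow_succ']
    exact ih.sub (integrable_arcMean ih a b)

theorem idSubPow_sub {f g : Circle2π → ℂ} (hf : Integrable f circleMeasure)
    (hg : Integrable g circleMeasure) (a b : ℝ) (r : ℕ) :
    idSubPow (arcMean a b) r (fun x => f x - g x) =
      fun x => idSubPow (arcMean a b) r f x - idSubPow (arcMean a b) r g x := by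
  induction r with
  | zero => rfl
  | succ r ih =>
    simp only [idSubPow_succ', ih]
    funext x
    rw [arcMean_sub (integrable_idSubPow hf a b r) (integrable_idSubPow hg a b r)]
    ring

theorem fourierCoeff_sub {f g : Circle2π → ℂ} (hf : Integrable f circleMeasure)
    (hg : Integrable g circleMeasure) (k : ℤ) :
    fourierCoeff (fun x => f x - g x) k = fourierCoeff f k - fourierCoeff g k := by
  have h := congrFun (fourierCoeff.add hf (g := fun x => (-1) * g x) (hg.const_mul (-1))) k
  rw [Pi.add_apply, fourierCoeff.const_mul] at h
  rw [sub_eq_add_neg, ← neg_one_mul, ← h]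
  congr 1
  funext x
  simp [sub_eq_add_neg]

theorem fourierCoeff_idSubPow {f : Circle2π → ℂ} (hf : Integrable f circleMeasure) (a b : ℝ)
    (r : ℕ) (k : ℤ) : fourierCoeff (idSubPow (arcMean a b) r f) k =
      (1 - arcSymbol a b k) ^ r * fourierCoeff f k := by
  induction r with
  | zero => simp [idSubPow_zero]
  | succ r ih =>
    have hr := integrable_idSubPow hf a b r
    rw [idSubPow_succ', fourierCoeff_sub hr (integrable_arcMean hr a b), fourierCoeff_arcMean hr, ih]
    ring

/-- The trigonometric polynomial of degree at most `N` with coefficients `c`. -/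
def trigPoly (N : ℕ) (c : ℤ → ℂ) (x : Circle2π) : ℂ :=
  ∑ k ∈ Finset.Icc (-(N : ℤ)) N, c k * fourier k x

theorem continuous_trigPoly (N : ℕ) (c : ℤ → ℂ) : Continuous (trigPoly N c) :=
  continuous_sum_fourier _ _

theorem integrable_trigPoly (N : ℕ) (c : ℤ → ℂ) : Integrable (trigPoly N c) circleMeasure :=
  (continuous_trigPoly N c).integrable_circleMeasure

theorem fourierCoeff_trigPoly (N : ℕ) (c : ℤ → ℂ) {k : ℤ} (hk : k ∈ Finset.Icc (-(N : ℤ)) N) :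
    fourierCoeff (trigPoly N c) k = c k := by
  have := fourierCoeff_sum_fourier (Finset.Icc (-(N : ℤ)) N) c k
  rwa [if_pos hk] at this

theorem trigPoly_sub (N : ℕ) (c d : ℤ → ℂ) (x : Circle2π) :
    trigPoly N (fun k => c k - d k) x = trigPoly N c x - trigPoly N d x := by
  simp only [trigPoly, sub_mul, Finset.sum_sub_distrib]

theorem trigPoly_congr {N : ℕ} {c d : ℤ → ℂ} (h : ∀ k ∈ Finset.Icc (-(N : ℤ)) N, c k = d k) :
    trigPoly N c = trigPoly N d := by
  funext x
  exact Finset.sum_congr rfl fun k hk => by rw [h k hk]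

theorem exists_trigPoly_eq_of_le {M N : ℕ} (h : M ≤ N) (c : ℤ → ℂ) :
    ∃ d : ℤ → ℂ, trigPoly M c = trigPoly N d := by
  refine ⟨fun k => if k ∈ Finset.Icc (-(M : ℤ)) M then c k else 0, ?_⟩
  funext x
  simp only [trigPoly, ite_mul, zero_mul]
  rw [← Finset.sum_filter, Finset.filter_mem_eq_inter, Finset.inter_eq_right.2]
  exact Finset.Icc_subset_Icc (by omega) (by omega)

theorem arcMean_trigPoly (a b : ℝ) (N : ℕ) (c : ℤ → ℂ) :
    arcMean a b (trigPoly N c) = trigPoly N (fun k => arcSymbol a b k * c k) := by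
  funext x
  exact arcMean_sum_fourier a b _ c x

theorem idSubPow_trigPoly (a b : ℝ) (r N : ℕ) (c : ℤ → ℂ) :
    idSubPow (arcMean a b) r (trigPoly N c) =
      trigPoly N (fun k => (1 - arcSymbol a b k) ^ r * c k) := by
  induction r with
  | zero => simp [idSubPow_zero]
  | succ r ih =>
    rw [idSubPow_succ', ih, arcMean_trigPoly]
    funext x
    rw [← trigPoly_sub]
    congr 1
    funext k
    ring

/-- Since 0 is excluded, consecutive integers have one sign and 1/(m(m+1)) telescopes; each end
contributes at most 1/n. -/
theorem sum_range_one_div_mul_succ_le {a : ℤ} {j n : ℕ} (hn : 0 < n)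
    (ha : ∀ i : ℕ, i ≤ j → (n : ℤ) ≤ |a + i|) :
    ∑ i ∈ Finset.range j, 1 / (|((a + i : ℤ) : ℝ)| * |((a + (i + 1) : ℤ) : ℝ)|) ≤ 2 / n := by
  have hne : ∀ i : ℕ, i ≤ j → ((a + i : ℤ) : ℝ) ≠ 0 := fun i hi => by
    have h1 := ha i hi
    have : a + i ≠ 0 := by
      intro h
      rw [h, abs_zero] at h1
      omega
    exact_mod_cast this
  have hterm : ∀ i ∈ Finset.range j, 1 / (|((a + i : ℤ) : ℝ)| * |((a + (i + 1) : ℤ) : ℝ)|) =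
      1 / ((a + (i : ℕ) : ℤ) : ℝ) - 1 / ((a + (i + 1 : ℕ) : ℤ) : ℝ) := by
    intro i hi
    rw [Finset.mem_range] at hi
    have h1 := hne i hi.le
    have h2 := hne (i + 1) hi
    rw [← abs_mul, ← Int.cast_mul, abs_of_nonneg]
    · push_cast at *
      field_simp
      ring
    · have : 0 ≤ (a + i) * (a + (i + 1)) := by
        rcases le_or_gt 0 (a + i) with h | h
        · exact mul_nonneg h (by omega)
        · exact mul_nonneg_of_nonpos_of_nonpos h.le (by omega)
      exact_mod_cast this
  rw [Finset.sum_congr rfl hterm,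
    Finset.sum_range_sub' (fun i : ℕ => 1 / ((a + (i : ℕ) : ℤ) : ℝ)) j]
  have hb : ∀ i : ℕ, i ≤ j → |1 / ((a + (i : ℕ) : ℤ) : ℝ)| ≤ 1 / n := fun i hi => by
    rw [abs_div, abs_one]
    have : (n : ℝ) ≤ |((a + i : ℤ) : ℝ)| := by exact_mod_cast ha i hi
    gcongr
  have h1 := (abs_le.1 (hb 0 (Nat.zero_le _))).2
  have h2 := (abs_le.1 (hb j le_rfl)).1
  have : (2 : ℝ) / n = 1 / n + 1 / n := by ring
  linarith

namespace BanachFunctionLattice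

variable {X : BanachFunctionLattice}

theorem mem_trigPoly (N : ℕ) (c : ℤ → ℂ) : X.Mem (trigPoly N c) :=
  mem_of_continuous (continuous_trigPoly N c)

theorem mem_idSubPow {f : Circle2π → ℂ} (hf : X.Mem f) (a b : ℝ) (r : ℕ) :
    X.Mem (idSubPow (arcMean a b) r f) := by
  induction r with
  | zero => exact hf
  | succ r ih =>
    rw [idSubPow_succ']
    exact ih.sub (mem_arcMean ih a b)

theorem nrm_idSubPow_le {a b : ℝ} {C : ℝ≥0}
    (hC : ∀ f, X.Mem f → X.nrm (arcMean a b f) ≤ C * X.nrm f) (r : ℕ) {f : Circle2π → ℂ}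
    (hf : X.Mem f) :
    X.nrm (idSubPow (arcMean a b) r f) ≤ ((1 + C) ^ r : ℝ≥0) * X.nrm f := by
  induction r with
  | zero => simp [idSubPow_zero]
  | succ r ih =>
    rw [idSubPow_succ']
    refine (sub_le _ _).trans ?_
    calc _ ≤ X.nrm (idSubPow (arcMean a b) r f) +
          C * X.nrm (idSubPow (arcMean a b) r f) := by
          gcongr
          exact hC _ (mem_idSubPow hf a b r)
      _ = (1 + C) * X.nrm (idSubPow (arcMean a b) r f) := by ring
      _ ≤ (1 + C) * (((1 + C) ^ r : ℝ≥0) * X.nrm f) := by gcongr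
      _ = _ := by
        push_cast
        ring

/-! ### Multipliers on trigonometric polynomials -/

/-- A function analytic on `[-πi, πi]` defines, by sampling at step `h`, multipliers that are
bounded on trigonometric polynomials of degree at most `π / h`. -/
theorem PartialSumsBounded.exists_nrm_trigPoly_le (hS : X.PartialSumsBounded) {f : ℂ → ℂ}
    (hf : ∀ t : ℝ, |t| ≤ Real.pi → AnalyticAt ℂ f (t * Complex.I)) :
    ∃ C : ℝ≥0, ∀ (h : ℝ) (N : ℕ), 0 < h → N * h ≤ Real.pi → ∀ g, X.Mem g →
      X.nrm (trigPoly N (fun k => f ((k * h : ℝ) * Complex.I) * fourierCoeff g k)) ≤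
        C * ENNReal.ofReal (‖f 0‖ + N * h) * X.nrm g := by
  obtain ⟨K, hK⟩ := hS.exists_nrm_multiplier_le
  obtain ⟨L, hL0, hL⟩ := exists_lipschitz_on_segment hf
  -- The last value is at most ‖f 0‖ + L·Nh and the 2N increments at most Lh each. Keeping ‖f 0‖ +
  -- Nh explicit yields a gain when f 0 = 0.
  refine ⟨K * Real.toNNReal (1 + 3 * L), fun h N hh hN g hg => ?_⟩
  have hle : ∀ k : ℤ, |k| ≤ N → |(k * h : ℝ)| ≤ Real.pi := fun k hk => by
    rw [abs_mul, abs_of_pos hh]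
    refine le_trans ?_ hN
    gcongr
    exact_mod_cast hk
  have hV : ‖f (((-(N : ℤ) + (2 * N : ℕ) : ℤ) * h : ℝ) * Complex.I)‖ +
      ∑ i ∈ Finset.range (2 * N), ‖f (((-(N : ℤ) + i : ℤ) * h : ℝ) * Complex.I) -
        f (((-(N : ℤ) + (i + 1) : ℤ) * h : ℝ) * Complex.I)‖ ≤ (1 + 3 * L) * (‖f 0‖ + N * h) := by
    have h1 : ‖f (((-(N : ℤ) + (2 * N : ℕ) : ℤ) * h : ℝ) * Complex.I)‖ ≤ ‖f 0‖ + L * (N * h) := by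
      have e : (((-(N : ℤ) + (2 * N : ℕ) : ℤ) : ℝ) * h) = N * h := by
        push_cast
        ring
      rw [e]
      have := hL (N * h) 0 (by rw [abs_of_nonneg (by positivity)]; exact hN)
        (by simpa using Real.pi_pos.le)
      rw [sub_zero, abs_of_nonneg (show 0 ≤ N * h by positivity), Complex.ofReal_zero,
        zero_mul] at this
      have h3 := norm_sub_norm_le (f ((N * h : ℝ) * Complex.I)) (f 0)
      linarith
    have h2 : ∑ i ∈ Finset.range (2 * N), ‖f (((-(N : ℤ) + i : ℤ) * h : ℝ) * Complex.I) -
        f (((-(N : ℤ) + (i + 1) : ℤ) * h : ℝ) * Complex.I)‖ ≤ (2 * N : ℕ) • (L * h) := by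
      calc _ ≤ ∑ _i ∈ Finset.range (2 * N), L * h := by
            refine Finset.sum_le_sum fun i hi => ?_
            rw [Finset.mem_range] at hi
            have k1 : |-(N : ℤ) + i| ≤ N := abs_le.2 (by omega)
            have k2 : |-(N : ℤ) + (i + 1)| ≤ N := abs_le.2 (by omega)
            refine (hL _ _ (hle _ k1) (hle _ k2)).trans (le_of_eq ?_)
            congr 1
            rw [← sub_mul, abs_mul, abs_of_pos hh]
            push_cast
            ring_nf
            simp
        _ = (2 * N : ℕ) • (L * h) := by rw [Finset.sum_const, Finset.card_range]
    rw [nsmul_eq_mul] at h2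
    push_cast at h2
    have h0 : 0 ≤ L * ‖f 0‖ := by positivity
    have h4 : 0 ≤ N * h := by positivity
    push_cast at *
    nlinarith
  have := hK (fun k => f ((k * h : ℝ) * Complex.I)) (-(N : ℤ)) (2 * N) _ hV g hg
  have e : -(N : ℤ) + (2 * N : ℕ) = N := by
    push_cast
    ring
  rw [e] at this
  refine this.trans (le_of_eq ?_)
  rw [ENNReal.ofReal_mul (by positivity), ENNReal.coe_mul]
  rw [← mul_assoc, ENNReal.ofReal]

/-- Uniform boundedness on polynomials of the multipliers of the preceding theorem. -/
theorem PartialSumsBounded.exists_nrm_trigPoly_le_const (hS : X.PartialSumsBounded) {f : ℂ → ℂ}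
    (hf : ∀ t : ℝ, |t| ≤ Real.pi → AnalyticAt ℂ f (t * Complex.I)) :
    ∃ C : ℝ≥0, ∀ (h : ℝ) (N : ℕ), 0 < h → N * h ≤ Real.pi → ∀ g, X.Mem g →
      X.nrm (trigPoly N (fun k => f ((k * h : ℝ) * Complex.I) * fourierCoeff g k)) ≤
        C * X.nrm g := by
  obtain ⟨C, hC⟩ := hS.exists_nrm_trigPoly_le hf
  refine ⟨C * Real.toNNReal (‖f 0‖ + Real.pi), fun h N hh hN g hg => (hC h N hh hN g hg).trans ?_⟩
  rw [ENNReal.coe_mul]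
  gcongr
  exact ENNReal.ofReal_le_ofReal (by linarith)

/-- Bernstein's inequality for the differences `(I - Ȧ_h)^s`. -/
theorem PartialSumsBounded.exists_bernstein (hS : X.PartialSumsBounded) (s : ℕ) :
    ∃ C : ℝ≥0, ∀ (h : ℝ) (N : ℕ), 0 < h → N * h ≤ Real.pi → ∀ c : ℤ → ℂ,
      X.nrm (idSubPow (arcMean 0 h) s (trigPoly N c)) ≤
        C * ENNReal.ofReal ((N * h) ^ s) * X.nrm (trigPoly N c) := by
  -- 1 - φ vanishes at 0, so every application of I - Ȧ_h gains a factor Nh.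
  obtain ⟨C, hC⟩ := hS.exists_nrm_trigPoly_le (f := fun z => 1 - expQuot z) fun t _ =>
    analyticAt_const.sub (differentiable_expQuot.analyticAt _)
  refine ⟨C ^ s, fun h N hh hN c => ?_⟩
  induction s with
  | zero => simp [idSubPow_zero]
  | succ s ih =>
    have h1 := hC h N hh hN _ (mem_trigPoly N (fun k => (1 - arcSymbol 0 h k) ^ s * c k))
    rw [trigPoly_congr (d := fun k => (1 - arcSymbol 0 h k) ^ (s + 1) * c k),
      ← idSubPow_trigPoly, ← idSubPow_trigPoly] at h1
    · refine h1.trans ?_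
      have hNh : 0 ≤ N * h := by positivity
      calc _ ≤ C * ENNReal.ofReal (N * h) *
            (((C ^ s : ℝ≥0) : ℝ≥0∞) * ENNReal.ofReal ((N * h) ^ s) * X.nrm (trigPoly N c)) := by
            gcongr
            simp [expQuot_zero]
        _ = _ := by
            rw [pow_succ, pow_succ, ENNReal.ofReal_mul (p := (N * h) ^ s) (by positivity),
              ENNReal.coe_mul]
            ring
    · intro k hk
      rw [fourierCoeff_trigPoly N _ hk, arcSymbol_zero_left hh]
      ring

/-- On polynomials, `(I - A_h)^r` is dominated by `(I - Ȧ_h)^s` when `s ≤ 2r`. -/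
theorem PartialSumsBounded.exists_nrm_idSubPow_trigPoly_le (hS : X.PartialSumsBounded)
    (hA : X.SteklovBounded) {r s : ℕ} (hrs : s ≤ 2 * r) :
    ∃ C : ℝ≥0, ∀ (h : ℝ) (N : ℕ), 0 < h → N * h ≤ Real.pi → ∀ c : ℤ → ℂ,
      X.nrm (idSubPow (steklov h) r (trigPoly N c)) ≤
        C * X.nrm (idSubPow (steklovDot h) s (trigPoly N c)) := by
  obtain ⟨κ, hκ⟩ := exists_analytic_quotient_symbol
  obtain ⟨C, hC⟩ := hS.exists_nrm_trigPoly_le_const fun t _ => (hκ t).1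
  obtain ⟨D, hD⟩ := hA.exists_nrm_steklovDot_le
  refine ⟨C ^ r * (1 + D) ^ (2 * r - s), fun h N hh hN c => ?_⟩
  simp only [steklov_eq_arcMean, steklovDot_eq_arcMean] at *
  -- Each factor I - A_h is traded for two factors I - Ȧ_h through the bounded multiplier κ.
  have h1 : ∀ (r : ℕ) (c : ℤ → ℂ),
      X.nrm (idSubPow (arcMean (-(h / 2)) (h / 2)) r (trigPoly N c)) ≤
      ((C ^ r : ℝ≥0) : ℝ≥0∞) *
        X.nrm (idSubPow (arcMean 0 h) (2 * r) (trigPoly N c)) := by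
    intro r
    induction r with
    | zero => intro c; simp [idSubPow_zero]
    | succ r ih =>
      intro c
      have e1 := ih fun k => (1 - arcSymbol (-(h / 2)) (h / 2) k) * c k
      have e2 := hC h N hh hN _ (mem_trigPoly N (fun k => (1 - arcSymbol 0 h k) ^ (2 * r + 2) * c k))
      rw [idSubPow_trigPoly, idSubPow_trigPoly] at e1 ⊢
      rw [trigPoly_congr (d := fun k => (1 - arcSymbol 0 h k) ^ (2 * r) *
        ((1 - arcSymbol (-(h / 2)) (h / 2) k) * c k))] at e2
      · have e3 : (fun k => (1 - arcSymbol (-(h / 2)) (h / 2) k) ^ (r + 1) * c k) =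
            fun k => (1 - arcSymbol (-(h / 2)) (h / 2) k) ^ r *
              ((1 - arcSymbol (-(h / 2)) (h / 2) k) * c k) := by
          funext k
          ring
        rw [e3, pow_succ, ENNReal.coe_mul, mul_assoc]
        exact e1.trans (by gcongr; exact e2)
      · intro k hk
        rw [fourierCoeff_trigPoly N _ hk, arcSymbol_zero_left hh, arcSymbol_neg_half hh, (hκ _).2]
        ring
  refine (h1 r c).trans ?_
  rw [ENNReal.coe_mul, mul_assoc]
  gcongr
  -- The surplus 2r - s factors I - Ȧ_h are merely bounded operators.
  rw [← Nat.sub_add_cancel hrs, idSubPow_add]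
  simp only [Nat.add_sub_cancel]
  exact nrm_idSubPow_le (fun f hf => hD f hf h hh) _ (mem_idSubPow (mem_trigPoly N c) 0 h s)

/-! ### Jackson's inequality -/

/-- For |k| ≥ n the argument kγ/n stays at distance γ from 0. With h = γ/n the variation is at most
(L/h)(2/n) = 2L/γ, independent of n and of the length of the window. -/
theorem PartialSumsBounded.exists_nrm_tail_le (hS : X.PartialSumsBounded) {γ : ℝ} (hγ : 0 < γ) :
    ∃ C : ℝ≥0, ∀ n : ℕ, 1 ≤ n → ∀ (a : ℤ) (j : ℕ), (∀ i : ℕ, i ≤ j → (n : ℤ) ≤ |a + i|) →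
      ∀ g, X.Mem g →
      X.nrm (fun x => ∑ k ∈ Finset.Icc a (a + j),
        tailSymbol (k * (γ / n)) * fourierCoeff g k * fourier k x) ≤ C * X.nrm g := by
  obtain ⟨K, hK⟩ := hS.exists_nrm_multiplier_le
  obtain ⟨L, hL0, hL1, hL2⟩ := exists_norm_tailSymbol_sub_le hγ
  refine ⟨K * Real.toNNReal (L + 2 * L / γ), fun n hn a j haj g hg => ?_⟩
  have hn0 : (0 : ℝ) < n := by exact_mod_cast hn
  set h := γ / n with hh
  have hhpos : 0 < h := div_pos hγ hn0
  have hge : ∀ i : ℕ, i ≤ j → γ ≤ |(((a + i : ℤ) : ℝ) * h)| := fun i hi => by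
    rw [abs_mul, abs_of_pos hhpos]
    have h1 : (n : ℝ) ≤ |((a + i : ℤ) : ℝ)| := by exact_mod_cast haj i hi
    calc γ = n * h := by rw [hh]; field_simp
      _ ≤ _ := by gcongr
  have hV : ‖tailSymbol (((a + j : ℤ) : ℝ) * h)‖ + ∑ i ∈ Finset.range j,
      ‖tailSymbol (((a + i : ℤ) : ℝ) * h) - tailSymbol (((a + (i + 1) : ℤ) : ℝ) * h)‖ ≤
      L + 2 * L / γ := by
    refine add_le_add (hL1 _ (hge j le_rfl)) ?_
    calc _ ≤ ∑ i ∈ Finset.range j,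
          L / h * (1 / (|((a + i : ℤ) : ℝ)| * |((a + (i + 1) : ℤ) : ℝ)|)) := by
          refine Finset.sum_le_sum fun i hi => ?_
          rw [Finset.mem_range] at hi
          have h2 := hge (i + 1) hi
          push_cast at h2
          refine (hL2 _ _ (hge i hi.le) (by push_cast; exact h2)).trans (le_of_eq ?_)
          rw [← sub_mul, abs_mul, abs_mul, abs_mul, abs_of_pos hhpos]
          have : |((a + i : ℤ) : ℝ) - ((a + (i + 1) : ℤ) : ℝ)| = 1 := by
            push_cast
            ring_nf
            simp
          rw [this]
          field_simp
      _ ≤ L / h * (2 / n) := by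
          rw [← Finset.mul_sum]
          gcongr
          exact sum_range_one_div_mul_succ_le hn haj
      _ = 2 * L / γ := by
          rw [hh]
          field_simp
  have := hK (fun k => tailSymbol (k * h)) a j _ hV g hg
  rw [ENNReal.coe_mul]
  exact this

/-- The tail estimate applies to windows on one side of 0, hence the two pieces. -/
theorem sum_Icc_eq_add_of_vanish {M : Type*} [AddCommMonoid M] (F : ℤ → M) (n j : ℕ)
    (hF : ∀ k : ℤ, |k| ≤ n → F k = 0) :
    ∑ k ∈ Finset.Icc (-((n + 1 + j : ℕ) : ℤ)) (n + 1 + j : ℕ), F k =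
      ∑ k ∈ Finset.Icc (-((n + 1 + j : ℕ) : ℤ)) (-((n + 1 + j : ℕ) : ℤ) + j), F k +
        ∑ k ∈ Finset.Icc (n + 1 : ℤ) (n + 1 + j), F k := by
  rw [← Finset.sum_union]
  · refine (Finset.sum_subset ?_ ?_).symm
    · intro k hk
      simp only [Finset.mem_union, Finset.mem_Icc] at *
      omega
    · intro k hk hk'
      simp only [Finset.mem_union, Finset.mem_Icc] at *
      exact hF k (abs_le.2 (by omega))
  · rw [Finset.disjoint_left]
    intro k hk hk'
    simp only [Finset.mem_Icc] at *
    omega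

/-- With g = u - Ȧu one has u = g + Ȧg + Ȧ²u, and Ȧ²u has coefficients `tailSymbol` times those of
g. Two averages also make these coefficients O(k⁻²), so the Fourier series converges pointwise and
Fatou passes the uniform bound on partial sums to Ȧ²u. -/
theorem exists_jackson_step (hS : X.PartialSumsBounded) (hA : X.SteklovBounded)
    {γ : ℝ} (hγ : 0 < γ) :
    ∃ C : ℝ≥0, ∀ n : ℕ, 1 ≤ n → ∀ u, X.Mem u → (∀ k : ℤ, |k| ≤ n → fourierCoeff u k = 0) →
      X.nrm u ≤ C * X.nrm (fun x => u x - arcMean 0 (γ / n) u x) := by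
  obtain ⟨K, hK⟩ := hS.exists_nrm_tail_le hγ
  obtain ⟨D, hD⟩ := hA.exists_nrm_steklovDot_le
  simp only [steklovDot_eq_arcMean] at hD
  refine ⟨1 + D + 2 * K, fun n hn u hu hvan => ?_⟩
  have hn0 : (0 : ℝ) < n := by exact_mod_cast hn
  set h := γ / n with hh
  have hhpos : 0 < h := div_pos hγ hn0
  set v := arcMean 0 h u with hv
  set F := arcMean 0 h v with hF
  set g : Circle2π → ℂ := fun x => u x - v x with hg
  have hvm : X.Mem v := mem_arcMean hu 0 h
  have hgm : X.Mem g := hu.sub hvm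
  have hFc : Continuous F := continuous_arcMean hvm.integrable 0 h
  have hFcoef : ∀ k, fourierCoeff F k =
      expQuot ((k * h : ℝ) * Complex.I) ^ 2 * fourierCoeff u k := fun k => by
    rw [hF, fourierCoeff_arcMean hvm.integrable, hv, fourierCoeff_arcMean hu.integrable,
      arcSymbol_zero_left hhpos]
    ring
  have hFvan : ∀ k : ℤ, |k| ≤ n → fourierCoeff F k = 0 := fun k hk => by
    rw [hFcoef, hvan k hk, mul_zero]
  have hFtail : ∀ k : ℤ, k ≠ 0 →
      fourierCoeff F k = tailSymbol (k * h) * fourierCoeff g k := fun k hk => by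
    rw [hFcoef, hg, fourierCoeff_sub hu.integrable hvm.integrable, hv,
      fourierCoeff_arcMean hu.integrable, arcSymbol_zero_left hhpos, tailSymbol]
    have h1 : (k * h : ℝ) ≠ 0 := mul_ne_zero (by exact_mod_cast hk) hhpos.ne'
    have h2 := sub_ne_zero.2 (expQuot_ne_one h1).symm
    field_simp
  have hsum : Summable (fourierCoeff (⟨F, hFc⟩ : C(Circle2π, ℂ))) := by
    set I := ∫ x, ‖u x‖ ∂circleMeasure
    refine Summable.of_norm_bounded
      (g := fun k : ℤ => 4 / h ^ 2 * I * (1 / (k : ℝ) ^ 2))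
      ((Real.summable_one_div_int_pow.2 one_lt_two).mul_left _) fun k => ?_
    change ‖fourierCoeff F k‖ ≤ _
    rcases eq_or_ne k 0 with rfl | hk
    · rw [hFvan 0 (by simp)]
      simp
    · have hk0 : (0 : ℝ) < |(k : ℝ)| := abs_pos.2 (by exact_mod_cast hk)
      rw [hFcoef, norm_mul, norm_pow]
      have h1 := abs_mul_norm_expQuot_le (k * h)
      rw [abs_mul, abs_of_pos hhpos] at h1
      have h2 : ‖expQuot ((k * h : ℝ) * Complex.I)‖ ≤ 2 / (|(k : ℝ)| * h) := by
        rw [le_div_iff₀ (by positivity), mul_comm]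
        exact h1
      calc _ ≤ (2 / (|(k : ℝ)| * h)) ^ 2 * I := by
            gcongr
            exact norm_fourierCoeff_le u k
        _ = _ := by
            rw [← sq_abs (k : ℝ)]
            field_simp
            ring
  have hlim : ∀ x, Tendsto (fun j : ℕ => ∑ k ∈ Finset.Icc (-((n + 1 + j : ℕ) : ℤ)) (n + 1 + j : ℕ),
      fourierCoeff F k * fourier k x) atTop (𝓝 (F x)) := by
    intro x
    have h1 : HasSum (fun k => fourierCoeff F k * fourier k x) (F x) :=
      has_pointwise_sum_fourier_series_of_summable hsum x
    have h2 : Tendsto (fun j : ℕ => n + 1 + j) atTop atTop :=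
      tendsto_atTop_mono (fun j => Nat.le_add_left j (n + 1)) tendsto_id
    exact (h1.comp (Finset.tendsto_Icc_neg (R := ℤ))).comp h2
  have hbound : ∀ j : ℕ, X.nrm (fun x =>
      ∑ k ∈ Finset.Icc (-((n + 1 + j : ℕ) : ℤ)) (n + 1 + j : ℕ),
        fourierCoeff F k * fourier k x) ≤ 2 * K * X.nrm g := by
    intro j
    have h1 := hK n hn (-((n + 1 + j : ℕ) : ℤ)) j (fun i hi => by rw [le_abs]; omega) g hgm
    have h2 := hK n hn (n + 1) j (fun i hi => by rw [le_abs]; omega) g hgm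
    have e : (fun x : Circle2π => ∑ k ∈ Finset.Icc (-((n + 1 + j : ℕ) : ℤ)) (n + 1 + j : ℕ),
        fourierCoeff F k * fourier k x) = fun x =>
        ∑ k ∈ Finset.Icc (-((n + 1 + j : ℕ) : ℤ)) (-((n + 1 + j : ℕ) : ℤ) + j),
          tailSymbol (k * h) * fourierCoeff g k * fourier k x +
        ∑ k ∈ Finset.Icc (n + 1 : ℤ) (n + 1 + j),
          tailSymbol (k * h) * fourierCoeff g k * fourier k x := by
      funext x
      rw [sum_Icc_eq_add_of_vanish _ n j fun k hk => by rw [hFvan k hk, zero_mul]]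
      congr 1 <;> refine Finset.sum_congr rfl fun k hk => ?_ <;> rw [Finset.mem_Icc] at hk <;>
        rw [hFtail k (by omega)]
    rw [e]
    refine (X.add_le _ _).trans ((add_le_add h1 h2).trans (le_of_eq ?_))
    ring
  have hFn : X.nrm F ≤ 2 * K * X.nrm g :=
    nrm_le_of_tendsto (ENNReal.mul_lt_top (by exact_mod_cast ENNReal.coe_lt_top (r := 2 * K)) hgm)
      hbound hFc.measurable.aemeasurable hlim
  have hu_eq : u = fun x => g x + (arcMean 0 h g x + F x) := by
    funext x
    rw [hg, arcMean_sub hu.integrable hvm.integrable]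
    ring
  calc X.nrm u = X.nrm (fun x => g x + (arcMean 0 h g x + F x)) := congrArg X.nrm hu_eq
    _ ≤ X.nrm g + (D * X.nrm g + 2 * K * X.nrm g) := by
        refine (X.add_le _ _).trans ?_
        gcongr
        refine (X.add_le _ _).trans ?_
        gcongr
        exact hD g hgm h hhpos
    _ = _ := by
        push_cast
        ring

/-- I - Ȧ is a multiplier and preserves the vanishing of low coefficients, so the one-step bound
iterates. -/
theorem exists_jackson_of_vanish (hS : X.PartialSumsBounded) (hA : X.SteklovBounded)
    {γ : ℝ} (hγ : 0 < γ) (s : ℕ) :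
    ∃ C : ℝ≥0, ∀ n : ℕ, 1 ≤ n → ∀ u, X.Mem u → (∀ k : ℤ, |k| ≤ n → fourierCoeff u k = 0) →
      X.nrm u ≤ C * X.nrm (idSubPow (arcMean 0 (γ / n)) s u) := by
  obtain ⟨C, hC⟩ := exists_jackson_step hS hA hγ
  refine ⟨C ^ s, fun n hn => ?_⟩
  induction s with
  | zero => intro u _ _; simp [idSubPow_zero]
  | succ s ih =>
    intro u hu hvan
    have hv := mem_arcMean hu 0 (γ / n)
    have h1 := ih (fun x => u x - arcMean 0 (γ / n) u x) (hu.sub hv) fun k hk => by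
      rw [fourierCoeff_sub hu.integrable hv.integrable, fourierCoeff_arcMean hu.integrable,
        hvan k hk, mul_zero, sub_zero]
    rw [idSubPow_succ, pow_succ', ENNReal.coe_mul, mul_assoc]
    exact (hC n hn u hu hvan).trans (by gcongr)

/-- Jackson's inequality for the Fourier partial sums. -/
theorem exists_jackson (hS : X.PartialSumsBounded) (hA : X.SteklovBounded)
    {γ : ℝ} (hγ : 0 < γ) (s : ℕ) :
    ∃ C : ℝ≥0, ∀ n : ℕ, 1 ≤ n → ∀ f, X.Mem f →
      X.nrm (fun x => f x - trigPoly n (fourierCoeff f) x) ≤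
        C * X.nrm (idSubPow (steklovDot (γ / n)) s f) := by
  obtain ⟨C, hC⟩ := exists_jackson_of_vanish hS hA hγ s
  obtain ⟨K, hK⟩ := hS
  refine ⟨C * (1 + K), fun n hn f hf => ?_⟩
  have hT := mem_trigPoly (X := X) n (fourierCoeff f)
  refine (hC n hn _ (hf.sub hT) fun k hk => ?_).trans ?_
  · rw [fourierCoeff_sub hf.integrable hT.integrable,
      fourierCoeff_trigPoly n _ (Finset.mem_Icc.2 (abs_le.1 hk)), sub_self]
  · rw [ENNReal.coe_mul, mul_assoc, idSubPow_sub hf.integrable hT.integrable, steklovDot_eq_arcMean]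
    gcongr
    set v := idSubPow (arcMean 0 (γ / n)) s f with hv
    have hvm : X.Mem v := mem_idSubPow hf _ _ _
    -- Multipliers commute: the difference of S_n f is S_n of the difference.
    have e : idSubPow (arcMean 0 (γ / n)) s (trigPoly n (fourierCoeff f)) =
        fourierPartialSum n v := by
      rw [idSubPow_trigPoly]
      refine trigPoly_congr (d := fourierCoeff v) fun k _ => ?_
      rw [hv, fourierCoeff_idSubPow hf.integrable]
    rw [e]
    refine (sub_le _ _).trans ?_
    calc _ ≤ X.nrm v + K * X.nrm v := by
          gcongr
          exact hK n v hvm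
      _ = _ := by
          push_cast
          ring

end BanachFunctionLattice

/-! ### Nodes and step functions -/

/-- The distance `2π / (2n + 1)` between consecutive nodes. -/
def mesh (n : ℕ) : ℝ := 2 * Real.pi / (2 * n + 1)

theorem mesh_pos (n : ℕ) : 0 < mesh n := by
  have := Real.pi_pos
  unfold mesh
  positivity

theorem mul_mesh_le_pi (n : ℕ) : n * mesh n ≤ Real.pi := by
  unfold mesh
  rw [← mul_div_assoc, div_le_iff₀ (by positivity)]
  nlinarith [Real.pi_pos]

theorem node_eq (n k : ℕ) : node n k = k * mesh n := by
  unfold node mesh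
  ring

theorem node_zero (n : ℕ) : node n 0 = 0 := by simp [node_eq]

theorem node_succ (n k : ℕ) : node n (k + 1) = node n k + mesh n := by
  simp only [node_eq]
  push_cast
  ring

theorem node_lt_succ (n k : ℕ) : node n k < node n (k + 1) := by
  rw [node_succ]
  linarith [mesh_pos n]

theorem node_last (n : ℕ) : node n (2 * n + 1) = 2 * Real.pi := by
  unfold node
  push_cast
  field_simp

theorem node_mono (n : ℕ) : Monotone (node n) :=
  monotone_nat_of_le_succ fun k => (node_lt_succ n k).le

theorem node_nonneg (n k : ℕ) : 0 ≤ node n k := by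
  rw [← node_zero n]
  exact node_mono n (Nat.zero_le k)

/-- The step function with value `v k` on `[t_k, t_{k+1})`. -/
def nodeStep (n : ℕ) (v : ℕ → ℂ) (x : Circle2π) : ℂ :=
  ∑ k ∈ Finset.range (2 * n + 1),
    (arc (node n k) (node n (k + 1))).indicator (fun _ => v k) x

theorem coe_mem_arc_iff {n j : ℕ} (hj : j < 2 * n + 1) {t : ℝ} (ht : t ∈ Set.Ico 0 (2 * Real.pi)) :
    (t : Circle2π) ∈ arc (node n j) (node n (j + 1)) ↔
      t ∈ Set.Ico (node n j) (node n (j + 1)) := by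
  refine ⟨?_, fun h => ⟨t, h, rfl⟩⟩
  rintro ⟨s, hs, hst⟩
  have hs' : s ∈ Set.Ico 0 (0 + 2 * Real.pi) := by
    refine ⟨(node_nonneg n j).trans hs.1, hs.2.trans_le ?_⟩
    rw [zero_add, ← node_last n]
    exact node_mono n hj
  have ht' : t ∈ Set.Ico 0 (0 + 2 * Real.pi) := by simpa using ht
  rwa [← (AddCircle.coe_eq_coe_iff_of_mem_Ico hs' ht').1 hst]

theorem nodeStep_apply {n k : ℕ} (hk : k < 2 * n + 1) {t : ℝ}
    (ht : t ∈ Set.Ico (node n k) (node n (k + 1))) (v : ℕ → ℂ) :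
    nodeStep n v (t : Circle2π) = v k := by
  have ht' : t ∈ Set.Ico 0 (2 * Real.pi) := by
    refine ⟨(node_nonneg n k).trans ht.1, ht.2.trans_le ?_⟩
    rw [← node_last n]
    exact node_mono n hk
  unfold nodeStep
  rw [Finset.sum_eq_single_of_mem k (Finset.mem_range.2 hk)]
  · rw [Set.indicator_of_mem ((coe_mem_arc_iff hk ht').2 ht)]
  · intro j hj hjk
    rw [Finset.mem_range] at hj
    rw [Set.indicator_of_notMem]
    rw [coe_mem_arc_iff hj ht']
    rintro ⟨h1, h2⟩
    rcases lt_or_gt_of_ne hjk with h | h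
    · exact absurd (h2.trans_le (node_mono n h)) (not_lt.2 ht.1)
    · exact absurd (ht.2.trans_le (node_mono n h)) (not_lt.2 h1)

theorem exists_node_add (n : ℕ) (x : Circle2π) :
    ∃ k < 2 * n + 1, ∃ d ∈ Set.Ico 0 (mesh n), x = ((node n k + d : ℝ) : Circle2π) := by
  obtain ⟨t, ht, rfl⟩ : ∃ t ∈ Set.Ico (0 : ℝ) (0 + 2 * Real.pi), (t : Circle2π) = x :=
    ⟨_, (AddCircle.equivIco (2 * Real.pi) 0 x).2, AddCircle.coe_equivIco⟩
  rw [zero_add] at ht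
  have hm := mesh_pos n
  have h0 : 0 ≤ t / mesh n := div_nonneg ht.1 hm.le
  refine ⟨⌊t / mesh n⌋₊, ?_, t - node n ⌊t / mesh n⌋₊, ⟨?_, ?_⟩, by simp⟩
  · rw [Nat.floor_lt h0, div_lt_iff₀ hm, ← node_eq, node_last]
    exact ht.2
  · rw [sub_nonneg, node_eq, ← le_div_iff₀ hm]
    exact Nat.floor_le h0
  · rw [sub_lt_iff_lt_add', ← node_succ, node_eq, ← div_lt_iff₀ hm]
    push_cast
    exact Nat.lt_floor_add_one _

theorem nodeStep_node_add {n k : ℕ} (hk : k < 2 * n + 1) {d : ℝ} (hd : d ∈ Set.Ico 0 (mesh n))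
    (v : ℕ → ℂ) : nodeStep n v ((node n k + d : ℝ) : Circle2π) = v k :=
  nodeStep_apply hk ⟨by linarith [hd.1], by rw [node_succ]; linarith [hd.2]⟩ v

/-- A half-open interval is a countable union of compact ones, whose images in the circle are
closed. -/
theorem measurableSet_arc (a b : ℝ) : MeasurableSet (arc a b) := by
  have h : Set.Ico a b = ⋃ m : ℕ, Set.Icc a (b - 1 / (m + 1)) := by
    ext t
    simp only [Set.mem_Ico, Set.mem_iUnion, Set.mem_Icc]
    constructor
    · rintro ⟨h1, h2⟩
      obtain ⟨m, hm⟩ := exists_nat_one_div_lt (sub_pos.2 h2)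
      exact ⟨m, h1, by linarith⟩
    · rintro ⟨m, h1, h2⟩
      have : (0 : ℝ) < 1 / (m + 1) := by positivity
      exact ⟨h1, by linarith⟩
  rw [arc, h, Set.image_iUnion]
  exact .iUnion fun m =>
    (isCompact_Icc.image (AddCircle.continuous_mk' (2 * Real.pi))).isClosed.measurableSet

theorem measurable_nodeStep (n : ℕ) (v : ℕ → ℂ) : Measurable (nodeStep n v) :=
  Finset.measurable_fun_sum _ fun _ _ => measurable_const.indicator (measurableSet_arc _ _)

theorem norm_nodeStep_le (n : ℕ) (v : ℕ → ℂ) (x : Circle2π) :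
    ‖nodeStep n v x‖ ≤ ∑ k ∈ Finset.range (2 * n + 1), ‖v k‖ := by
  obtain ⟨k, hk, d, hd, rfl⟩ := exists_node_add n x
  rw [nodeStep_node_add hk hd]
  exact Finset.single_le_sum (f := fun k => ‖v k‖) (fun i _ => norm_nonneg _) (Finset.mem_range.2 hk)

/-- Every arc contributes the character at its left end times one common factor. Dividing by that
factor recovers the coefficients of the interpolant from an element of X. -/
theorem fourierCoeff_nodeStep (n : ℕ) (v : ℕ → ℂ) (j : ℤ)
    (hint : Integrable (nodeStep n v) circleMeasure) :
    fourierCoeff (nodeStep n v) j = expQuot (-((j * mesh n : ℝ) * Complex.I)) *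
      ((1 / (2 * n + 1) : ℂ) * ∑ k ∈ Finset.range (2 * n + 1),
        v k * fourier (-j) (node n k : Circle2π)) := by
  have hII : ∀ a b : ℝ, IntervalIntegrable
      (fun t : ℝ => fourier (-j) (t : Circle2π) • nodeStep n v (t : Circle2π)) volume a b :=
    fun a b => by simpa using intervalIntegrable_translate (hint.fourier_smul (-j)) 0 a b
  have hpiece : ∀ k ∈ Finset.range (2 * n + 1), ∫ t in (node n k)..(node n (k + 1)),
      fourier (-j) (t : Circle2π) • nodeStep n v (t : Circle2π) =
      mesh n * expQuot (-((j * mesh n : ℝ) * Complex.I)) *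
        (v k * fourier (-j) (node n k : Circle2π)) := by
    intro k hk
    rw [Finset.mem_range] at hk
    have hsym := arcSymbol_eq (node_lt_succ n k) (-j)
    have e1 : ∫ t in (node n k)..(node n (k + 1)),
        fourier (-j) (t : Circle2π) • nodeStep n v (t : Circle2π) =
        ∫ t in (node n k)..(node n (k + 1)), fourier (-j) (t : Circle2π) * v k := by
      rw [intervalIntegral.integral_of_le (node_lt_succ n k).le,
        intervalIntegral.integral_of_le (node_lt_succ n k).le,
        ← integral_Ico_eq_integral_Ioc, ← integral_Ico_eq_integral_Ioc]
      refine setIntegral_congr_fun measurableSet_Ico fun t ht => ?_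
      simp only [smul_eq_mul]
      rw [nodeStep_apply hk ht]
    have e2 : Complex.exp (((-j : ℤ) * node n k : ℝ) * Complex.I) =
        fourier (-j) (node n k : Circle2π) := by
      rw [fourier_coe_apply]
      congr 1
      have : (Real.pi : ℂ) ≠ 0 := by exact_mod_cast Real.pi_ne_zero
      push_cast
      field_simp
    have e3 : node n (k + 1) - node n k = mesh n := by
      rw [node_succ]
      ring
    have hm : (mesh n : ℂ) ≠ 0 := by exact_mod_cast (mesh_pos n).ne'
    rw [arcSymbol, e2, e3] at hsym
    have e4 : ∫ t in (node n k)..(node n (k + 1)), (fourier (-j) (t : Circle2π) : ℂ) =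
        mesh n * (fourier (-j) (node n k : Circle2π) *
          expQuot (((-j : ℤ) * mesh n : ℝ) * Complex.I)) := by
      rw [← hsym]
      push_cast
      field_simp
    have e5 : (((-j : ℤ) * mesh n : ℝ) : ℂ) * Complex.I = -((j * mesh n : ℝ) * Complex.I) := by
      push_cast
      ring
    rw [e1, intervalIntegral.integral_mul_const, e4, e5]
    ring
  have htotal := intervalIntegral.sum_integral_adjacent_intervals (a := node n) (n := 2 * n + 1)
    fun k _ => hII (node n k) (node n (k + 1))
  rw [Finset.sum_congr rfl hpiece, ← Finset.mul_sum, node_last, node_zero] at htotal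
  rw [fourierCoeff_eq_intervalIntegral _ _ 0, zero_add, ← htotal]
  have hm : (mesh n : ℂ) = 2 * Real.pi / (2 * n + 1) := by
    unfold mesh
    push_cast
    rfl
  have : (Real.pi : ℂ) ≠ 0 := by exact_mod_cast Real.pi_ne_zero
  have h2 : (2 * n + 1 : ℂ) ≠ 0 := by exact_mod_cast Nat.succ_ne_zero (2 * n)
  rw [Complex.real_smul, hm]
  push_cast
  field_simp

/-! ### Trigonometric interpolation -/

theorem sum_pow_exp_root {n : ℕ} {m : ℤ} (hm : |m| < 2 * n + 1) :
    ∑ k ∈ Finset.range (2 * n + 1),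
      Complex.exp (2 * Real.pi * Complex.I * ((m : ℂ) / (2 * n + 1))) ^ k =
      if m = 0 then (2 * n + 1 : ℂ) else 0 := by
  have hpi : (Real.pi : ℂ) ≠ 0 := by exact_mod_cast Real.pi_ne_zero
  have h2 : (2 * n + 1 : ℂ) ≠ 0 := by exact_mod_cast Nat.succ_ne_zero (2 * n)
  split_ifs with h
  · simp [h]
  · have hone : Complex.exp (2 * Real.pi * Complex.I * ((m : ℂ) / (2 * n + 1))) ≠ 1 := by
      intro h1
      rw [Complex.exp_eq_one_iff] at h1
      obtain ⟨q, hq⟩ := h1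
      have hI := Complex.I_ne_zero
      have h3 : (m : ℂ) = q * (2 * n + 1) := by
        field_simp at hq
        linear_combination hq
      have h4 : m = q * (2 * n + 1) := by exact_mod_cast h3
      refine h (Int.eq_zero_of_abs_lt_dvd (m := 2 * n + 1) ⟨q, by linarith⟩ hm)
    have hroot : Complex.exp (2 * Real.pi * Complex.I * ((m : ℂ) / (2 * n + 1))) ^ (2 * n + 1) =
        1 := by
      rw [← Complex.exp_nat_mul, Complex.exp_eq_one_iff]
      refine ⟨m, ?_⟩
      push_cast
      field_simp
    rw [geom_sum_eq hone, hroot, sub_self, zero_div]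

theorem dirichlet_node_sub {n j k : ℕ} (hj : j < 2 * n + 1) (hk : k < 2 * n + 1) :
    dirichlet n ((node n j : Circle2π) - (node n k : Circle2π)) =
      if j = k then (2 * n + 1 : ℂ) else 0 := by
  have hcard : ∀ F : ℤ → ℂ, ∑ i ∈ Finset.Icc (-(n : ℤ)) n, F i =
      ∑ i ∈ Finset.range (2 * n + 1), F (-(n : ℤ) + i) := fun F => by
    rw [← sum_Icc_int_eq_sum_range]
    congr 2
    push_cast
    ring
  rw [dirichlet, hcard]
  split_ifs with h
  · simp [h]
  · set x : Circle2π := (node n j : Circle2π) - (node n k : Circle2π) with hx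
    have hxe : x = ((node n j - node n k : ℝ) : Circle2π) := by simp [hx]
    have hpow : ∀ i : ℕ, (fourier (-(n : ℤ) + i) x : ℂ) = fourier (-(n : ℤ)) x * (fourier 1 x) ^ i := by
      intro i
      rw [fourier_add]
      congr 1
      induction i with
      | zero => simp
      | succ i ih =>
        rw [Nat.cast_succ, fourier_add, ih, pow_succ]
    have hpi : (Real.pi : ℂ) ≠ 0 := by exact_mod_cast Real.pi_ne_zero
    have h2 : (2 * n + 1 : ℂ) ≠ 0 := by exact_mod_cast Nat.succ_ne_zero (2 * n)
    have hz : (fourier 1 x : ℂ) =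
        Complex.exp (2 * Real.pi * Complex.I * (((j : ℂ) - k) / (2 * n + 1))) := by
      rw [hxe, fourier_coe_apply]
      congr 1
      simp only [node]
      push_cast
      field_simp
    have hm := sum_pow_exp_root (n := n) (m := (j : ℤ) - k) (abs_lt.2 (by omega))
    rw [if_neg (by omega)] at hm
    push_cast at hm
    rw [← hz] at hm
    simp only [hpow]
    rw [← Finset.mul_sum, hm, mul_zero]

theorem lagrange_node (n : ℕ) (f : Circle2π → ℂ) {j : ℕ} (hj : j < 2 * n + 1) :
    lagrange n f (node n j : Circle2π) = f (node n j : Circle2π) := by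
  have h2 : (2 * n + 1 : ℂ) ≠ 0 := by exact_mod_cast Nat.succ_ne_zero (2 * n)
  rw [lagrange, Finset.sum_eq_single_of_mem j (Finset.mem_range.2 hj)]
  · rw [dirichlet_node_sub hj hj, if_pos rfl]
    field_simp
  · intro k hk hkj
    rw [dirichlet_node_sub hj (Finset.mem_range.1 hk), if_neg hkj.symm, mul_zero]

/-- The discrete Fourier coefficients of the samples of `f`. -/
def sampleCoeff (n : ℕ) (f : Circle2π → ℂ) (j : ℤ) : ℂ :=
  (1 / (2 * n + 1) : ℂ) * ∑ k ∈ Finset.range (2 * n + 1),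
    f (node n k : Circle2π) * fourier (-j) (node n k : Circle2π)

theorem lagrange_eq_trigPoly (n : ℕ) (f : Circle2π → ℂ) :
    lagrange n f = trigPoly n (sampleCoeff n f) := by
  funext x
  simp only [lagrange, trigPoly, dirichlet, sampleCoeff, Finset.mul_sum, Finset.sum_mul]
  rw [Finset.sum_comm]
  refine Finset.sum_congr rfl fun j _ => Finset.sum_congr rfl fun k _ => ?_
  have : (fourier j (x - (node n k : Circle2π)) : ℂ) =
      fourier j x * fourier (-j) (node n k : Circle2π) := by
    rw [sub_eq_add_neg, fourier_apply_add, ← fourier_neg_neg j (-(node n k : Circle2π)), neg_neg]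
  rw [this]
  ring

/-- No aliasing: differences of two admissible frequencies are at most 2n, below the number of
nodes. -/
theorem sampleCoeff_trigPoly (n : ℕ) (c : ℤ → ℂ) {j : ℤ} (hj : j ∈ Finset.Icc (-(n : ℤ)) n) :
    sampleCoeff n (trigPoly n c) j = c j := by
  have h2 : (2 * n + 1 : ℂ) ≠ 0 := by exact_mod_cast Nat.succ_ne_zero (2 * n)
  have hpow : ∀ (m : ℤ) (k : ℕ), (fourier m (node n k : Circle2π) : ℂ) =
      Complex.exp (2 * Real.pi * Complex.I * ((m : ℂ) / (2 * n + 1))) ^ k := by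
    intro m k
    rw [fourier_coe_apply, ← Complex.exp_nat_mul]
    congr 1
    have : (Real.pi : ℂ) ≠ 0 := by exact_mod_cast Real.pi_ne_zero
    simp only [node]
    push_cast
    field_simp
  have hsum : ∑ k ∈ Finset.range (2 * n + 1),
      trigPoly n c (node n k : Circle2π) * fourier (-j) (node n k : Circle2π) =
      ∑ i ∈ Finset.Icc (-(n : ℤ)) n, c i * (if i - j = 0 then (2 * n + 1 : ℂ) else 0) := by
    simp only [trigPoly, Finset.sum_mul]
    rw [Finset.sum_comm]
    refine Finset.sum_congr rfl fun i hi => ?_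
    rw [Finset.mem_Icc] at hi hj
    rw [← sum_pow_exp_root (m := i - j) (abs_lt.2 (by omega)), Finset.mul_sum]
    refine Finset.sum_congr rfl fun k _ => ?_
    rw [mul_assoc, ← fourier_add, ← sub_eq_add_neg, hpow]
  rw [sampleCoeff, hsum, Finset.sum_eq_single_of_mem j hj]
  · rw [sub_self, if_pos rfl]
    field_simp
  · intro i _ hij
    rw [if_neg (sub_ne_zero.2 hij), mul_zero]

theorem lagrange_trigPoly (n : ℕ) (c : ℤ → ℂ) : lagrange n (trigPoly n c) = trigPoly n c := by
  rw [lagrange_eq_trigPoly]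
  exact trigPoly_congr fun _ hk => sampleCoeff_trigPoly n c hk

theorem lagrange_sub (n : ℕ) (f g : Circle2π → ℂ) (x : Circle2π) :
    lagrange n (fun x => f x - g x) x = lagrange n f x - lagrange n g x := by
  simp only [lagrange, sub_mul, Finset.sum_sub_distrib, mul_sub]

namespace BanachFunctionLattice

variable {X : BanachFunctionLattice}

/-! ### The discrete seminorm -/

theorem mem_nodeStep (n : ℕ) (v : ℕ → ℂ) : X.Mem (nodeStep n v) :=
  mem_of_bounded (measurable_nodeStep n v).aemeasurable _ (norm_nodeStep_le n v)

theorem discreteNrm_eq (n : ℕ) (f : Circle2π → ℂ) :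
    X.discreteNrm n f = X.nrm (nodeStep n fun k => ((‖f (node n k : Circle2π)‖ : ℝ) : ℂ)) :=
  rfl

theorem discreteNrm_le_nrm {n : ℕ} {f G : Circle2π → ℂ} {c : ℝ} (hG : X.Mem G)
    (h : ∀ (k : ℕ), ∀ d ∈ Set.Ico 0 (mesh n), ‖f (node n k : Circle2π)‖ ≤
      c * ‖G ((node n k : Circle2π) + (d : Circle2π))‖) :
    X.discreteNrm n f ≤ ENNReal.ofReal c * X.nrm G := by
  rw [discreteNrm_eq]
  refine nrm_le_of_norm_le_mul hG (measurable_nodeStep n _).aemeasurable fun x => ?_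
  obtain ⟨k, hk, d, hd, rfl⟩ := exists_node_add n x
  rw [nodeStep_node_add hk hd, AddCircle.coe_add]
  simpa using h k d hd

theorem discreteNrm_le_add {n : ℕ} {f g₁ g₂ : Circle2π → ℂ}
    (h : ∀ k < 2 * n + 1, ‖f (node n k : Circle2π)‖ ≤
      ‖g₁ (node n k : Circle2π)‖ + ‖g₂ (node n k : Circle2π)‖) :
    X.discreteNrm n f ≤ X.discreteNrm n g₁ + X.discreteNrm n g₂ := by
  simp only [discreteNrm_eq]
  refine le_trans ?_ (X.add_le _ _)
  refine nrm_le_of_norm_le ((mem_nodeStep n _).add (mem_nodeStep n _))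
    (measurable_nodeStep n _).aemeasurable fun x => ?_
  obtain ⟨k, hk, d, hd, rfl⟩ := exists_node_add n x
  simp only [nodeStep_node_add hk hd, ← Complex.ofReal_add, Complex.norm_real, norm_norm]
  rw [Real.norm_of_nonneg (by positivity)]
  exact h k hk

theorem discreteNrm_eq_zero {n : ℕ} {f : Circle2π → ℂ}
    (h : ∀ k < 2 * n + 1, f (node n k : Circle2π) = 0) : X.discreteNrm n f = 0 := by
  rw [discreteNrm_eq, ← nrm_zero (X := X)]
  congr 1
  funext x
  obtain ⟨k, hk, d, hd, rfl⟩ := exists_node_add n x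
  rw [nodeStep_node_add hk hd, h k hk]
  simp

/-- Sampling a Steklov average with step comparable to the mesh is bounded. -/
theorem SteklovBounded.exists_discreteNrm_arcMean_le (hA : X.SteklovBounded) {γ : ℝ} (hγ : 0 < γ) :
    ∃ C : ℝ≥0, ∀ n : ℕ, 1 ≤ n → ∀ a b : ℝ, b - a = γ / n → -(γ / n) ≤ a → b ≤ γ / n →
      ∀ f, X.Mem f → X.discreteNrm n (arcMean a b f) ≤ C * X.nrm f := by
  obtain ⟨C, hC⟩ := hA.exists_nrm_le
  refine ⟨Real.toNNReal ((2 * γ + 2 * Real.pi) / γ) * C, fun n hn a b hab ha hb f hf => ?_⟩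
  have hn0 : (0 : ℝ) < n := by exact_mod_cast hn
  have hh : 0 < γ / n := div_pos hγ hn0
  -- H/2 = γ/n + π/n covers the reach of the arc from its node plus the offset d < mesh ≤ π/n, so a
  -- centred average at any point of [t_k, t_{k+1}) dominates the average at t_k.
  set H := (2 * γ + 2 * Real.pi) / n with hH
  have hHpos : 0 < H := by positivity
  have hH2 : H / 2 = γ / n + Real.pi / n := by
    rw [hH]
    field_simp
  have hmesh : mesh n ≤ Real.pi / n := by
    rw [le_div_iff₀ hn0, mul_comm]
    exact mul_mesh_le_pi n
  have hratio : H / (b - a) = (2 * γ + 2 * Real.pi) / γ := by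
    rw [hab, hH]
    field_simp
  have h1 : X.discreteNrm n (arcMean a b f) ≤ ENNReal.ofReal (H / (b - a)) *
      X.nrm (steklov H fun y => ((‖f y‖ : ℝ) : ℂ)) := by
    refine discreteNrm_le_nrm (hA.1 _ hf.norm H hHpos) fun k d hd => ?_
    exact norm_arcMean_le hf.integrable (by linarith) (by linarith [hd.1, hd.2])
      (by linarith [hd.1, hd.2, Real.pi_pos, div_pos Real.pi_pos hn0]) _
  refine h1.trans ?_
  rw [hratio, ENNReal.coe_mul, mul_assoc]
  gcongr
  · exact le_rfl
  · exact (hC _ hf.norm H hHpos).trans (by gcongr; exact nrm_norm_le hf)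

/-- Marcinkiewicz–Zygmund inequality: samples of a polynomial are controlled by its norm. -/
theorem exists_discreteNrm_trigPoly_le (hS : X.PartialSumsBounded) (hA : X.SteklovBounded)
    {γ : ℝ} (hγ : 0 < γ) (hγπ : γ ≤ Real.pi) :
    ∃ C : ℝ≥0, ∀ n : ℕ, 1 ≤ n → ∀ c : ℤ → ℂ,
      X.discreteNrm n (trigPoly n c) ≤ C * X.nrm (trigPoly n c) := by
  obtain ⟨C, hC⟩ := hA.exists_discreteNrm_arcMean_le hγ
  obtain ⟨D, hD⟩ := hS.exists_nrm_trigPoly_le_const (f := fun z => (expQuot z)⁻¹) fun t ht =>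
    (differentiable_expQuot.analyticAt _).inv (expQuot_ne_zero ht)
  refine ⟨C * D, fun n hn c => ?_⟩
  have hn0 : (0 : ℝ) < n := by exact_mod_cast hn
  have hh : 0 < γ / n := div_pos hγ hn0
  have hnh : n * (γ / n) = γ := by field_simp
  -- T is the preimage of the polynomial under Ȧ_{γ/n}; samples of the average of T are controlled
  -- by ‖T‖.
  set T := trigPoly n fun k =>
    (expQuot ((k * (γ / n) : ℝ) * Complex.I))⁻¹ * fourierCoeff (trigPoly n c) k with hT
  have e : arcMean 0 (γ / n) T = trigPoly n c := by
    rw [hT, arcMean_trigPoly]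
    refine trigPoly_congr fun k hk => ?_
    rw [fourierCoeff_trigPoly n c hk, arcSymbol_zero_left hh, mul_inv_cancel_left₀]
    refine expQuot_ne_zero ?_
    rw [Finset.mem_Icc] at hk
    rw [abs_mul, abs_of_pos hh]
    calc |(k : ℝ)| * (γ / n) ≤ n * (γ / n) := by
          gcongr
          exact_mod_cast abs_le.2 hk
      _ ≤ Real.pi := hnh.trans_le hγπ
  calc X.discreteNrm n (trigPoly n c) = X.discreteNrm n (arcMean 0 (γ / n) T) := by rw [e]
    _ ≤ C * X.nrm T := hC n hn 0 (γ / n) (by ring) (by linarith) le_rfl T (mem_trigPoly n _)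
    _ ≤ C * (D * X.nrm (trigPoly n c)) := by
        gcongr
        exact hD (γ / n) n hh (hnh.trans_le hγπ) _ (mem_trigPoly n c)
    _ = _ := by
        rw [ENNReal.coe_mul, mul_assoc]

/-- Marcinkiewicz–Zygmund inequality: an interpolation polynomial is controlled by its samples. -/
theorem PartialSumsBounded.exists_nrm_lagrange_le (hS : X.PartialSumsBounded) :
    ∃ C : ℝ≥0, ∀ (n : ℕ) (f : Circle2π → ℂ), X.nrm (lagrange n f) ≤ C * X.discreteNrm n f := by
  have hne : ∀ t : ℝ, |t| ≤ Real.pi → expQuot (-(t * Complex.I)) ≠ 0 := fun t ht => by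
    have := expQuot_ne_zero (t := -t) (by rwa [abs_neg])
    rwa [Complex.ofReal_neg, neg_mul] at this
  obtain ⟨C, hC⟩ := hS.exists_nrm_trigPoly_le_const (f := fun z => (expQuot (-z))⁻¹) fun t ht =>
    ((differentiable_expQuot.comp differentiable_neg).analyticAt _).inv (hne t ht)
  refine ⟨C, fun n f => ?_⟩
  -- The step function of the signed samples has modulus equal to the one defining the discrete
  -- norm, and its mesh satisfies n · mesh ≤ π.
  set g := nodeStep n (fun k => f (node n k : Circle2π)) with hg
  have hgm : X.Mem g := mem_nodeStep n _
  have h1 := hC (mesh n) n (mesh_pos n) (mul_mesh_le_pi n) g hgm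
  have e : lagrange n f = trigPoly n fun k =>
      (expQuot (-((k * mesh n : ℝ) * Complex.I)))⁻¹ * fourierCoeff g k := by
    rw [lagrange_eq_trigPoly]
    refine trigPoly_congr fun k hk => ?_
    rw [hg, fourierCoeff_nodeStep n _ k hgm.integrable, inv_mul_cancel_left₀]
    · rfl
    · refine hne _ ?_
      rw [Finset.mem_Icc] at hk
      rw [abs_mul, abs_of_pos (mesh_pos n)]
      refine le_trans ?_ (mul_mesh_le_pi n)
      have := mesh_pos n
      gcongr
      exact_mod_cast abs_le.2 hk
  rw [e]
  refine h1.trans ?_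
  gcongr
  rw [discreteNrm_eq]
  refine nrm_le_of_norm_le (mem_nodeStep n _) hgm.aemeasurable fun x => ?_
  obtain ⟨k, hk, d, hd, rfl⟩ := exists_node_add n x
  rw [hg, nodeStep_node_add hk hd, nodeStep_node_add hk hd]
  simp

/-- At the nodes, `(I - A_h)^r u` and `u` differ by at most a multiple of the norm of `u`. -/
theorem SteklovBounded.exists_discreteNrm_idSubPow_sub_le (hA : X.SteklovBounded)
    {γ : ℝ} (hγ : 0 < γ) (r : ℕ) :
    ∃ C : ℝ≥0, ∀ n : ℕ, 1 ≤ n → ∀ u, X.Mem u →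
      X.discreteNrm n (fun x => idSubPow (steklov (γ / n)) r u x - u x) ≤ C * X.nrm u := by
  obtain ⟨C, hC⟩ := hA.exists_discreteNrm_arcMean_le hγ
  obtain ⟨D, hD⟩ := hA.exists_nrm_le
  simp only [steklov_eq_arcMean] at *
  induction r with
  | zero =>
    refine ⟨0, fun n _ u _ => ?_⟩
    rw [discreteNrm_eq_zero fun k _ => by simp [idSubPow_zero]]
    exact zero_le
  | succ r ih =>
    obtain ⟨E, hE⟩ := ih
    refine ⟨E + C * (1 + D) ^ r, fun n hn u hu => ?_⟩
    have hh : 0 < γ / n := div_pos hγ (by exact_mod_cast hn)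
    set P := arcMean (-(γ / n / 2)) (γ / n / 2) with hP
    have hr : X.Mem (idSubPow P r u) := mem_idSubPow hu _ _ r
    -- Each new factor only adds the average P(I - P)^r u, so u itself is never sampled.
    calc _ ≤ X.discreteNrm n (fun x => idSubPow P r u x - u x) +
          X.discreteNrm n (P (idSubPow P r u)) := by
          refine discreteNrm_le_add fun k _ => ?_
          rw [idSubPow_succ']
          refine le_trans (le_of_eq ?_) (_root_.norm_sub_le _ _)
          congr 1
          ring
      _ ≤ E * X.nrm u + C * (((1 + D) ^ r : ℝ≥0) * X.nrm u) := by
          gcongr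
          · exact hE n hn u hu
          · refine (hC n hn _ _ (by ring) (by linarith) (by linarith) _ hr).trans ?_
            gcongr
            exact nrm_idSubPow_le (fun f hf => hD f hf _ hh) r hu
      _ = _ := by
          push_cast
          ring

/-! ### Rates of approximation by trigonometric interpolation -/

/-- The direct estimate for trigonometric interpolation. -/
theorem exists_nrm_sub_lagrange_le (hS : X.PartialSumsBounded) (hA : X.SteklovBounded)
    {r s : ℕ} (hrs : s ≤ 2 * r) {γ : ℝ} (hγ : 0 < γ) (hγπ : γ ≤ Real.pi) :
    ∃ C : ℝ≥0, ∀ n : ℕ, 1 ≤ n → ∀ f, X.Mem f →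
      X.nrm (fun x => f x - lagrange n f x) ≤
        C * (X.discreteNrm n (idSubPow (steklov (γ / n)) r f) +
          X.nrm (idSubPow (steklovDot (γ / n)) s f)) := by
  obtain ⟨J, hJ⟩ := exists_jackson hS hA hγ s
  obtain ⟨M, hM⟩ := exists_discreteNrm_trigPoly_le hS hA hγ hγπ
  obtain ⟨Λ, hΛ⟩ := hS.exists_nrm_lagrange_le
  obtain ⟨E, hE⟩ := hA.exists_discreteNrm_idSubPow_sub_le hγ r
  obtain ⟨K, hK⟩ := hS.exists_nrm_idSubPow_trigPoly_le hA hrs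
  obtain ⟨D, hD⟩ := hA.exists_nrm_steklovDot_le
  refine ⟨J + Λ * (1 + E * J + M * K * (1 + (1 + D) ^ s * J)), fun n hn f hf => ?_⟩
  have hn0 : (0 : ℝ) < n := by exact_mod_cast hn
  have hh : 0 < γ / n := div_pos hγ hn0
  have hnh : n * (γ / n) ≤ Real.pi := by
    rw [mul_div_cancel₀ _ hn0.ne']
    exact hγπ
  set T := trigPoly n (fourierCoeff f) with hT
  have hTm : X.Mem T := mem_trigPoly n _
  set u : Circle2π → ℂ := fun x => f x - T x with hu
  have hum : X.Mem u := hf.sub hTm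
  set a := X.discreteNrm n (idSubPow (steklov (γ / n)) r f)
  set b := X.nrm (idSubPow (steklovDot (γ / n)) s f)
  have hub : X.nrm u ≤ J * b := hJ n hn f hf
  have hdot : X.nrm (idSubPow (steklovDot (γ / n)) s T) ≤ (1 + ((1 + D) ^ s : ℝ≥0) * J) * b := by
    have e : idSubPow (steklovDot (γ / n)) s u = fun x =>
        idSubPow (steklovDot (γ / n)) s f x - idSubPow (steklovDot (γ / n)) s T x := by
      rw [steklovDot_eq_arcMean]
      exact idSubPow_sub hf.integrable hTm.integrable _ _ _
    have h1 : X.nrm (idSubPow (steklovDot (γ / n)) s u) ≤ ((1 + D) ^ s : ℝ≥0) * X.nrm u := by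
      simp only [steklovDot_eq_arcMean] at *
      exact nrm_idSubPow_le (fun f hf => hD f hf _ hh) s hum
    calc _ ≤ X.nrm (fun x => idSubPow (steklovDot (γ / n)) s T x -
            idSubPow (steklovDot (γ / n)) s f x) + b := le_sub_add _ _
      _ = X.nrm (idSubPow (steklovDot (γ / n)) s u) + b := by rw [nrm_sub_comm, e]
      _ ≤ ((1 + D) ^ s : ℝ≥0) * (J * b) + b := by
          gcongr
          exact h1.trans (by gcongr)
      _ = _ := by ring
  -- ‖u‖ does not control samples of u. They are exchanged, up to averages, for those of (I - A_h)^r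
  -- u, which split into the given term for f and a polynomial term for T.
  have hdisc : X.discreteNrm n u ≤
      a + E * (J * b) + M * (K * ((1 + ((1 + D) ^ s : ℝ≥0) * J) * b)) := by
    have e : ∀ x, idSubPow (steklov (γ / n)) r u x =
        idSubPow (steklov (γ / n)) r f x - idSubPow (steklov (γ / n)) r T x := fun x => by
      rw [steklov_eq_arcMean]
      exact congrFun (idSubPow_sub hf.integrable hTm.integrable _ _ _) x
    have h1 : X.discreteNrm n u ≤ X.discreteNrm n (idSubPow (steklov (γ / n)) r u) +
        X.discreteNrm n (fun x => idSubPow (steklov (γ / n)) r u x - u x) := by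
      refine discreteNrm_le_add fun k _ => ?_
      refine le_trans (le_of_eq ?_) (_root_.norm_sub_le _ _)
      congr 1
      ring
    have h2 : X.discreteNrm n (idSubPow (steklov (γ / n)) r u) ≤
        a + X.discreteNrm n (idSubPow (steklov (γ / n)) r T) := by
      refine discreteNrm_le_add fun k _ => ?_
      rw [e]
      exact _root_.norm_sub_le _ _
    have h3 : X.discreteNrm n (idSubPow (steklov (γ / n)) r T) ≤
        M * (K * ((1 + ((1 + D) ^ s : ℝ≥0) * J) * b)) := by
      have h4 := hK (γ / n) n hh hnh (fourierCoeff f)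
      rw [← hT] at h4
      have h5 : X.discreteNrm n (idSubPow (steklov (γ / n)) r T) ≤
          M * X.nrm (idSubPow (steklov (γ / n)) r T) := by
        rw [steklov_eq_arcMean, hT, idSubPow_trigPoly]
        exact hM n hn _
      refine h5.trans ?_
      gcongr
      exact h4.trans (by gcongr)
    calc _ ≤ a + M * (K * ((1 + ((1 + D) ^ s : ℝ≥0) * J) * b)) + E * (J * b) :=
          h1.trans (add_le_add (h2.trans (by gcongr)) ((hE n hn u hum).trans (by gcongr)))
      _ = _ := by ring
  have hsplit : (fun x => f x - lagrange n f x) = fun x => u x - lagrange n u x := by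
    funext x
    rw [hu, lagrange_sub, hT, lagrange_trigPoly]
    ring
  rw [hsplit]
  calc _ ≤ X.nrm u + X.nrm (lagrange n u) := sub_le _ _
    _ ≤ J * b + Λ * (a + E * (J * b) + M * (K * ((1 + ((1 + D) ^ s : ℝ≥0) * J) * b))) := by
        gcongr
        exact (hΛ n u).trans (by gcongr)
    -- The added bracket is the first with a and b exchanged, so that the sum factors through a + b.
    _ ≤ (J * b + Λ * (a + E * (J * b) + M * (K * ((1 + ((1 + D) ^ s : ℝ≥0) * J) * b)))) +
        (J * a + Λ * (b + E * (J * a) + M * (K * ((1 + ((1 + D) ^ s : ℝ≥0) * J) * a)))) :=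
        le_self_add
    _ = _ := by
        push_cast
        ring

/-- The discrete modulus is controlled by the interpolation error and the integral modulus. -/
theorem exists_discreteNrm_idSubPow_le (hS : X.PartialSumsBounded) (hA : X.SteklovBounded)
    {r s : ℕ} (hrs : s ≤ 2 * r) {γ : ℝ} (hγ : 0 < γ) (hγπ : γ ≤ Real.pi) :
    ∃ C : ℝ≥0, ∀ n : ℕ, 1 ≤ n → ∀ f, X.Mem f →
      X.discreteNrm n (idSubPow (steklov (γ / n)) r f) ≤
        C * (X.nrm (fun x => f x - lagrange n f x) +
          X.nrm (idSubPow (steklovDot (γ / n)) s f)) := by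
  obtain ⟨M, hM⟩ := exists_discreteNrm_trigPoly_le hS hA hγ hγπ
  obtain ⟨E, hE⟩ := hA.exists_discreteNrm_idSubPow_sub_le hγ r
  obtain ⟨K, hK⟩ := hS.exists_nrm_idSubPow_trigPoly_le hA hrs
  obtain ⟨D, hD⟩ := hA.exists_nrm_steklovDot_le
  refine ⟨E + M * K * (1 + (1 + D) ^ s), fun n hn f hf => ?_⟩
  have hn0 : (0 : ℝ) < n := by exact_mod_cast hn
  have hh : 0 < γ / n := div_pos hγ hn0
  have hnh : n * (γ / n) ≤ Real.pi := by
    rw [mul_div_cancel₀ _ hn0.ne']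
    exact hγπ
  set T := trigPoly n (sampleCoeff n f) with hT
  have hTm : X.Mem T := mem_trigPoly n _
  rw [lagrange_eq_trigPoly, ← hT]
  set u : Circle2π → ℂ := fun x => f x - T x with hu
  have hum : X.Mem u := hf.sub hTm
  set b := X.nrm (idSubPow (steklovDot (γ / n)) s f)
  have hdot : X.nrm (idSubPow (steklovDot (γ / n)) s T) ≤
      ((1 + D) ^ s : ℝ≥0) * X.nrm u + b := by
    have e : idSubPow (steklovDot (γ / n)) s u = fun x =>
        idSubPow (steklovDot (γ / n)) s f x - idSubPow (steklovDot (γ / n)) s T x := by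
      rw [steklovDot_eq_arcMean]
      exact idSubPow_sub hf.integrable hTm.integrable _ _ _
    have h1 : X.nrm (idSubPow (steklovDot (γ / n)) s u) ≤ ((1 + D) ^ s : ℝ≥0) * X.nrm u := by
      simp only [steklovDot_eq_arcMean] at *
      exact nrm_idSubPow_le (fun f hf => hD f hf _ hh) s hum
    calc _ ≤ X.nrm (fun x => idSubPow (steklovDot (γ / n)) s T x -
            idSubPow (steklovDot (γ / n)) s f x) + b := le_sub_add _ _
      _ = X.nrm (idSubPow (steklovDot (γ / n)) s u) + b := by rw [nrm_sub_comm, e]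
      _ ≤ _ := by gcongr
  have e : ∀ x, idSubPow (steklov (γ / n)) r u x =
      idSubPow (steklov (γ / n)) r f x - idSubPow (steklov (γ / n)) r T x := fun x => by
    rw [steklov_eq_arcMean]
    exact congrFun (idSubPow_sub hf.integrable hTm.integrable _ _ _) x
  -- Since u vanishes at the nodes, the samples of (I - A_h)^r u are those of (I - A_h)^r u - u,
  -- hence bounded by ‖u‖.
  have huzero : ∀ k < 2 * n + 1, u (node n k : Circle2π) = 0 := fun k hk => by
    rw [hu, hT, ← lagrange_eq_trigPoly]
    simp only [lagrange_node n f hk, sub_self]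
  have h1 : X.discreteNrm n (idSubPow (steklov (γ / n)) r f) ≤
      X.discreteNrm n (fun x => idSubPow (steklov (γ / n)) r u x - u x) +
        X.discreteNrm n (idSubPow (steklov (γ / n)) r T) := by
    refine discreteNrm_le_add fun k hk => ?_
    refine le_trans (le_of_eq ?_) (norm_add_le _ _)
    rw [e, huzero k hk]
    congr 1
    ring
  have h2 : X.discreteNrm n (idSubPow (steklov (γ / n)) r T) ≤
      M * (K * (((1 + D) ^ s : ℝ≥0) * X.nrm u + b)) := by
    have h4 := hK (γ / n) n hh hnh (sampleCoeff n f)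
    rw [← hT] at h4
    have h5 : X.discreteNrm n (idSubPow (steklov (γ / n)) r T) ≤
        M * X.nrm (idSubPow (steklov (γ / n)) r T) := by
      rw [steklov_eq_arcMean, hT, idSubPow_trigPoly]
      exact hM n hn _
    refine h5.trans ?_
    gcongr
    exact h4.trans (by gcongr)
  calc _ ≤ E * X.nrm u + M * (K * (((1 + D) ^ s : ℝ≥0) * X.nrm u + b)) :=
        h1.trans (add_le_add (hE n hn u hum) h2)
    _ ≤ (E * X.nrm u + M * (K * (((1 + D) ^ s : ℝ≥0) * X.nrm u + b))) +
        (E * b + M * (K * (((1 + D) ^ s : ℝ≥0) * b + X.nrm u))) := le_self_add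
    _ = _ := by
        push_cast
        ring

end BanachFunctionLattice

/-! ### Rates of decay and the inverse theorem. -/

theorem IsBigORate.of_le_mul {a b : ℕ → ℝ≥0∞} {α : ℝ} (hb : IsBigORate b α) {C : ℝ≥0}
    (h : ∀ n : ℕ, 1 ≤ n → a n ≤ C * b n) : IsBigORate a α := by
  obtain ⟨D, hD⟩ := hb
  refine ⟨C * D, ?_⟩
  filter_upwards [hD, eventually_ge_atTop 1] with n hn h1
  rw [ENNReal.coe_mul, mul_assoc]
  exact (h n h1).trans (by gcongr)

theorem IsBigORate.add {a b : ℕ → ℝ≥0∞} {α : ℝ} (ha : IsBigORate a α) (hb : IsBigORate b α) :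
    IsBigORate (fun n => a n + b n) α := by
  obtain ⟨C, hC⟩ := ha
  obtain ⟨D, hD⟩ := hb
  refine ⟨C + D, ?_⟩
  filter_upwards [hC, hD] with n h1 h2
  rw [ENNReal.coe_add, add_mul]
  exact add_le_add h1 h2

namespace BanachFunctionLattice

variable {X : BanachFunctionLattice}

/-- Dyadic form of the inverse theorem: differences of near-best approximants. -/
theorem PartialSumsBounded.exists_nrm_idSubPow_dyadic_le (hS : X.PartialSumsBounded) {s : ℕ}
    {ρ : ℝ} (hρ0 : 0 < ρ) (hρ1 : ρ ≤ 1) (hρ : 1 < 2 ^ s * ρ) {f : Circle2π → ℂ} {c : ℕ → ℤ → ℂ}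
    {C : ℝ≥0} {m₀ : ℕ}
    (hc : ∀ m, m₀ ≤ m → X.nrm (fun x => f x - trigPoly (2 ^ m) (c m) x) ≤
      C * ENNReal.ofReal (ρ ^ m)) :
    ∃ K : ℝ, 0 ≤ K ∧ ∀ m, m₀ ≤ m → ∀ h : ℝ, 0 < h → 2 ^ m * h ≤ Real.pi →
      X.nrm (idSubPow (arcMean 0 h) s (trigPoly (2 ^ m) (c m))) ≤
        ENNReal.ofReal (K * (h ^ s * (2 ^ s * ρ) ^ m)) := by
  obtain ⟨B, hB⟩ := hS.exists_bernstein s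
  set q := 2 ^ s * ρ with hq
  have hq0 : 0 < q := by positivity
  set A : ℝ := (X.nrm (trigPoly (2 ^ m₀) (c m₀))).toReal with hA
  have hAe : X.nrm (trigPoly (2 ^ m₀) (c m₀)) = ENNReal.ofReal A :=
    (ENNReal.ofReal_toReal (mem_trigPoly (X := X) _ _).ne_top).symm
  have hA0 : 0 ≤ A := ENNReal.toReal_nonneg
  -- K₁ covers the initial polynomial. Each dyadic block costs K₂(q - 1) h^s q^m, and as q > 1 these
  -- costs sum geometrically to K₂ h^s q^m.
  set K₁ : ℝ := B * A / ρ ^ m₀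
  set K₂ : ℝ := B * 2 ^ s * (2 * C) / (q - 1)
  have hK₁ : 0 ≤ K₁ := by positivity
  have hK₂ : 0 ≤ K₂ := div_nonneg (by positivity) (by linarith)
  refine ⟨K₁ + K₂, add_nonneg hK₁ hK₂, fun m hm => ?_⟩
  induction m, hm using Nat.le_induction with
  | base =>
    intro h hh hle
    refine (hB h (2 ^ m₀) hh (by push_cast; exact hle) (c m₀)).trans ?_
    rw [hAe, ← ENNReal.ofReal_coe_nnreal, ← ENNReal.ofReal_mul (by positivity),
      ← ENNReal.ofReal_mul (by positivity)]
    refine ENNReal.ofReal_le_ofReal ?_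
    have e : B * ((((2 ^ m₀ : ℕ) : ℝ) * h) ^ s) * A = K₁ * (h ^ s * q ^ m₀) := by
      simp only [K₁, hq]
      push_cast
      rw [mul_pow, mul_pow, ← pow_mul, ← pow_mul, mul_comm s m₀]
      field_simp
    push_cast at e ⊢
    rw [e]
    gcongr
    linarith
  | succ m hm ih =>
    intro h hh hle
    have hle' : 2 ^ m * h ≤ Real.pi := by
      refine le_trans ?_ hle
      gcongr
      · norm_num
      · omega
    -- Both approximants are read as polynomials of degree 2^(m+1), so Bernstein applies to their
    -- difference.
    obtain ⟨d, hd⟩ := exists_trigPoly_eq_of_le (M := 2 ^ m) (N := 2 ^ (m + 1))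
      (Nat.pow_le_pow_right (by norm_num) (Nat.le_succ m)) (c m)
    set Δ := trigPoly (2 ^ (m + 1)) (fun k => c (m + 1) k - d k) with hΔ
    have hΔe : Δ = fun x => trigPoly (2 ^ (m + 1)) (c (m + 1)) x - trigPoly (2 ^ m) (c m) x := by
      funext x
      rw [hΔ, trigPoly_sub, hd]
    have hΔn : X.nrm Δ ≤ ENNReal.ofReal (2 * C * ρ ^ m) := by
      have e : Δ = fun x => (f x - trigPoly (2 ^ m) (c m) x) -
          (f x - trigPoly (2 ^ (m + 1)) (c (m + 1)) x) := by
        rw [hΔe]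
        funext x
        ring
      rw [e]
      calc _ ≤ C * ENNReal.ofReal (ρ ^ m) + C * ENNReal.ofReal (ρ ^ (m + 1)) :=
            (sub_le _ _).trans (add_le_add (hc m hm) (hc (m + 1) (by omega)))
        _ ≤ C * ENNReal.ofReal (ρ ^ m) + C * ENNReal.ofReal (ρ ^ m) := by
            gcongr _ + _ * ENNReal.ofReal ?_
            exact pow_le_pow_of_le_one hρ0.le hρ1 (Nat.le_succ m)
        _ = _ := by
            rw [← ENNReal.ofReal_coe_nnreal, ← ENNReal.ofReal_mul (by positivity),
              ← ENNReal.ofReal_add (by positivity) (by positivity)]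
            congr 1
            ring
    have hΔs : X.nrm (idSubPow (arcMean 0 h) s Δ) ≤
        ENNReal.ofReal (B * 2 ^ s * (2 * C) * (h ^ s * q ^ m)) := by
      refine (hB h (2 ^ (m + 1)) hh (by push_cast; exact hle) _).trans ?_
      refine (mul_le_mul_right hΔn _).trans (le_of_eq ?_)
      rw [← ENNReal.ofReal_coe_nnreal, ← ENNReal.ofReal_mul (by positivity),
        ← ENNReal.ofReal_mul (by positivity)]
      congr 1
      simp only [hq]
      push_cast
      rw [mul_pow, mul_pow, ← pow_mul, ← pow_mul, mul_comm s m]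
      ring
    have hsplit : idSubPow (arcMean 0 h) s (trigPoly (2 ^ (m + 1)) (c (m + 1))) = fun x =>
        idSubPow (arcMean 0 h) s Δ x + idSubPow (arcMean 0 h) s (trigPoly (2 ^ m) (c m)) x := by
      rw [hΔe, idSubPow_sub (integrable_trigPoly _ _) (integrable_trigPoly _ _)]
      funext x
      ring
    rw [hsplit]
    refine (X.add_le _ _).trans ((add_le_add hΔs (ih h hh hle')).trans ?_)
    have hP : 0 ≤ h ^ s * q ^ m := by positivity
    rw [← ENNReal.ofReal_add (by positivity) (mul_nonneg (add_nonneg hK₁ hK₂) hP), ← add_mul,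
      pow_succ q m]
    refine ENNReal.ofReal_le_ofReal ?_
    have h1 : B * 2 ^ s * (2 * C) = K₂ * (q - 1) := by
      simp only [K₂]
      rw [div_mul_cancel₀ _ (by linarith)]
    have h2 : B * 2 ^ s * (2 * C) + (K₁ + K₂) ≤ (K₁ + K₂) * q := by
      rw [h1]
      nlinarith
    calc (B * 2 ^ s * (2 * C) + (K₁ + K₂)) * (h ^ s * q ^ m)
        ≤ ((K₁ + K₂) * q) * (h ^ s * q ^ m) := by gcongr
      _ = _ := by ring

/-- The inverse theorem: approximation of order `n^{-α}` by trigonometric polynomials forces the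
integral modulus of order `s > α` to decay at the same rate. -/
theorem isBigORate_idSubPow_of_approx (hS : X.PartialSumsBounded) (hA : X.SteklovBounded)
    {s : ℕ} {γ α : ℝ} (hγ : 0 < γ) (hγπ : γ ≤ Real.pi) (hα : α ∈ Set.Ioo (0 : ℝ) s)
    {f : Circle2π → ℂ} (hf : X.Mem f) (c : ℕ → ℤ → ℂ)
    (hc : IsBigORate (fun n => X.nrm (fun x => f x - trigPoly n (c n) x)) α) :
    IsBigORate (fun n => X.nrm (idSubPow (steklovDot (γ / n)) s f)) α := by
  obtain ⟨C, hC⟩ := hc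
  obtain ⟨m₀, hm₀⟩ := eventually_atTop.1 hC
  obtain ⟨D, hD⟩ := hA.exists_nrm_steklovDot_le
  simp only [steklovDot_eq_arcMean] at hD ⊢
  set ρ : ℝ := 2 ^ (-α) with hρ
  have hρ0 : 0 < ρ := by positivity
  have hρ1 : ρ ≤ 1 := Real.rpow_le_one_of_one_le_of_nonpos one_le_two (by linarith [hα.1])
  -- This is the condition α < s.
  have hρq : 1 < 2 ^ s * ρ := by
    rw [hρ, ← Real.rpow_natCast, ← Real.rpow_add two_pos]
    exact Real.one_lt_rpow one_lt_two (by linarith [hα.2])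
  have hpow : ∀ m : ℕ, (((2 ^ m : ℕ) : ℝ)) ^ (-α) = ρ ^ m := fun m => by
    rw [hρ, ← Real.rpow_natCast, ← Real.rpow_mul two_pos.le, mul_comm, Real.rpow_mul two_pos.le]
    push_cast
    rw [Real.rpow_natCast]
  have hdy : ∀ m, m₀ ≤ m → X.nrm (fun x => f x - trigPoly (2 ^ m) (c (2 ^ m)) x) ≤
      C * ENNReal.ofReal (ρ ^ m) := fun m hm => by
    rw [← hpow]
    exact hm₀ (2 ^ m) (hm.trans (Nat.lt_two_pow_self).le)
  obtain ⟨K, hK0, hK⟩ := hS.exists_nrm_idSubPow_dyadic_le hρ0 hρ1 hρq hdy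
  refine ⟨Real.toNNReal (((1 + D) ^ s * C + K * γ ^ s) * 2 ^ α), ?_⟩
  filter_upwards [eventually_ge_atTop (2 ^ m₀)] with n hn
  have hn1 : n ≠ 0 := by
    rintro rfl
    simp at hn
  have hn0 : (0 : ℝ) < n := by exact_mod_cast Nat.pos_of_ne_zero hn1
  -- The largest dyadic degree not exceeding n: then 2^m γ/n ≤ γ ≤ π, and n ≤ 2 · 2^m loses only the
  -- factor 2^α in the rate.
  set m := Nat.log 2 n with hm
  have hmm : m₀ ≤ m := Nat.le_log_of_pow_le one_lt_two hn
  have hlow : (2 : ℝ) ^ m ≤ n := by exact_mod_cast Nat.pow_log_le_self 2 hn1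
  have hupp : (n : ℝ) ≤ 2 * 2 ^ m := by
    have := (Nat.lt_pow_succ_log_self one_lt_two n).le
    rw [pow_succ, mul_comm] at this
    exact_mod_cast this
  have hh : 0 < γ / n := div_pos hγ hn0
  have hmh : 2 ^ m * (γ / n) ≤ γ := by
    rw [← mul_div_assoc, div_le_iff₀ hn0, mul_comm]
    gcongr
  set T := trigPoly (2 ^ m) (c (2 ^ m)) with hT
  have hTm : X.Mem T := mem_trigPoly _ _
  have h1 : X.nrm (idSubPow (arcMean 0 (γ / n)) s (fun x => f x - T x)) ≤
      ENNReal.ofReal ((1 + D) ^ s * C * ρ ^ m) := by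
    refine (nrm_idSubPow_le (fun f hf => hD f hf _ hh) s (hf.sub hTm)).trans ?_
    refine (mul_le_mul_right (hdy m hmm) _).trans (le_of_eq ?_)
    rw [← ENNReal.ofReal_coe_nnreal, ← ENNReal.ofReal_coe_nnreal (p := C),
      ← ENNReal.ofReal_mul (by positivity), ← ENNReal.ofReal_mul (by positivity)]
    congr 1
    push_cast
    ring
  have h2 : X.nrm (idSubPow (arcMean 0 (γ / n)) s T) ≤ ENNReal.ofReal (K * γ ^ s * ρ ^ m) := by
    refine (hK m hmm (γ / n) hh (hmh.trans hγπ)).trans (ENNReal.ofReal_le_ofReal ?_)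
    calc K * ((γ / n) ^ s * (2 ^ s * ρ) ^ m) = K * (2 ^ m * (γ / n)) ^ s * ρ ^ m := by
          rw [mul_pow, mul_pow, ← pow_mul, ← pow_mul, mul_comm s m]
          ring
      _ ≤ _ := by gcongr
  have h3 : ρ ^ m ≤ 2 ^ α * (n : ℝ) ^ (-α) := by
    rw [← hpow]
    push_cast
    calc ((2 : ℝ) ^ m) ^ (-α) ≤ ((n : ℝ) / 2) ^ (-α) :=
          Real.rpow_le_rpow_of_nonpos (by positivity) (by linarith) (by linarith [hα.1])
      _ = _ := by
          rw [Real.div_rpow hn0.le two_pos.le, Real.rpow_neg two_pos.le, div_inv_eq_mul, mul_comm]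
  calc X.nrm (idSubPow (arcMean 0 (γ / n)) s f)
      ≤ X.nrm (idSubPow (arcMean 0 (γ / n)) s (fun x => f x - T x)) +
          X.nrm (idSubPow (arcMean 0 (γ / n)) s T) := by
        rw [idSubPow_sub hf.integrable hTm.integrable]
        exact le_sub_add _ _
    _ ≤ ENNReal.ofReal ((1 + D) ^ s * C * ρ ^ m) + ENNReal.ofReal (K * γ ^ s * ρ ^ m) :=
        add_le_add h1 h2
    _ = ENNReal.ofReal (((1 + D) ^ s * C + K * γ ^ s) * ρ ^ m) := by
        rw [← ENNReal.ofReal_add (by positivity) (by positivity), add_mul]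
    _ ≤ ENNReal.ofReal (((1 + D) ^ s * C + K * γ ^ s) * (2 ^ α * (n : ℝ) ^ (-α))) := by
        refine ENNReal.ofReal_le_ofReal ?_
        gcongr
    _ = _ := by
        rw [← mul_assoc, ENNReal.ofReal_mul (by positivity)]
        rfl

end BanachFunctionLattice

end BanachLatticeSampling

end

/-! ### The equivalence. -/

theorem corollary3p7 (X : BanachLatticeSampling.BanachFunctionLattice)
    (hA : X.SteklovBounded) (hS : X.PartialSumsBounded)
    (r s : ℕ) (hr : 1 ≤ r) (hs : 1 ≤ s) (hrs : s ≤ 2 * r)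
    (γ : ℝ) (hγ : 0 < γ)
    (hγ_sep : ∀ n k : ℕ, 1 ≤ n →
      γ / n ≤ BanachLatticeSampling.node n (k + 1) - BanachLatticeSampling.node n k)
    (α : ℝ) (hα : α ∈ Set.Ioo (0 : ℝ) s)
    (f : BanachLatticeSampling.Circle2π → ℂ) (hf : X.Mem f) :
    BanachLatticeSampling.IsBigORate
      (fun n => X.nrm (fun x => f x - BanachLatticeSampling.lagrange n f x)) α ↔
    BanachLatticeSampling.IsBigORate
      (fun n => X.discreteNrm n
          (BanachLatticeSampling.idSubPow (BanachLatticeSampling.steklov (γ / n)) r f) +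
        X.nrm (BanachLatticeSampling.idSubPow
          (BanachLatticeSampling.steklovDot (γ / n)) s f)) α := by
  -- The case n = 1 suffices: γ is at most the first mesh, hence at most π, which keeps kγ/n in [-π,
  -- π] for |k| ≤ n.
  have hγπ : γ ≤ Real.pi := by
    have h1 := hγ_sep 1 0 le_rfl
    have h2 := BanachLatticeSampling.mul_mesh_le_pi 1
    rw [BanachLatticeSampling.node_succ] at h1
    simp only [Nat.cast_one, div_one, one_mul] at h1 h2
    linarith
  constructor
  · intro h
    -- The interpolants themselves serve as the approximating polynomials.
    have hint := BanachLatticeSampling.BanachFunctionLattice.isBigORate_idSubPow_of_approx hS hA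
      hγ hγπ hα hf (fun n => BanachLatticeSampling.sampleCoeff n f)
      (by simpa only [BanachLatticeSampling.lagrange_eq_trigPoly] using h)
    obtain ⟨C, hC⟩ := BanachLatticeSampling.BanachFunctionLattice.exists_discreteNrm_idSubPow_le
      hS hA hrs hγ hγπ
    exact ((h.add hint).of_le_mul fun n hn => hC n hn f hf).add hint
  · intro h
    obtain ⟨C, hC⟩ := BanachLatticeSampling.BanachFunctionLattice.exists_nrm_sub_lagrange_le
      hS hA hrs hγ hγπ
    exact h.of_le_mul fun n hn => hC n hn f hf
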